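/- Let $H$ be a separable complex Hilbert space and let $\alpha:\mathcal B(H)\to\mathcal B(H)$ be a non-zero endomorphism (a $*$-homomorphism, not necessarily unital). A \emph{transfer operator} for $(\mathcal B(H),\alpha)$ is a continuous positive linear map $\mathcal L:\mathcal B(H)\to\mathcal B(H)$ with $\mathcal L(\alpha(a)b)=a\mathcal L(b)$ for all $a,b$. It is \emph{non-degenerate} if $\alpha\circ\mathcal L$ is a conditional expectation of $\mathcal B(H)$ onto $\alpha(\mathcal B(H))$ (a positive contractive linear projection that is a bimodule map over the range). It is \emph{complete} if $\ker\alpha$ is unital, $\alpha(\mathcal B(H))$ is a hereditary subalgebra, and, for each $a$, $\mathcal L(a)$ is the element of the annihilator $(\ker\alpha)^\perp$ with $\alpha(\mathcal L(a))=\alpha(1)a\alpha(1)$. A positive map (or functional) is \emph{normal} if it preserves suprema of upward directed families of self-adjoint elements, and \emph{singular} if it annihilates the compact operators. There are $n\in\{1,2,\dots,\infty\}$ and isometries $U_i$, $1\le i\le n$ (with $i$ ranging over $\mathbb N$ if $n=\infty$), on $H$ with mutually orthogonal ranges such that $$\alpha(a)=\sum_{i=1}^n U_iaU_i^*\qquad(a\in\mathcal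 B(H)),$$ the sum being weakly convergent. For any such $n$ and $(U_i)$, fix an index $i_0$, put $U=U_{i_0}$, $H_0=UU^*H$ and regard $\mathcal B(H_0)$ as $UU^*\mathcal B(H)UU^*$; let $H_n$ be a Hilbert space with orthonormal basis $(e_i)_{i=1}^n$. For $a\in\mathcal B(H_0)$ and $b\in\mathcal B(H_n)$ let $$a\otimes b=\sum_{i,j=1}^n b(i,j)\,U_i\,(U^*aU)\,U_j^*\in\mathcal B(H),\qquad b(i,j)=\langle be_j,e_i\rangle ,$$ the weak limit of the sums over $i,j\in F$, with $F$ running through the finite sets of indices; this limit exists. Then for every transfer operator $\mathcal L$ for $(\mathcal B(H),\alpha)$ there is a positive linear functional $\omega$ on $\mathcal B(H_n)$ such that $$\mathcal L(a\otimes b)=U^*aU\,\omega(b)\qquad (a\in\mathcal B(H_0),\ b\in\mathcal B(H_n)).\tag{$*$}$$ Moreover: (i) Relation $(*)$ establishes an isometric isomorphism between the cone of normal transfer operators $\mathcal L$ for $(\mathcal B(H),\alpha)$ and the cone of normal positive linear functionals $\omega$ on $\mathcal B(H_n)$: it is an additive, positively homogeneous bijection that preserves norms and distances. (ii) If a transfer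 operator $\mathcal L$ and a positive functional $\omega$ are related by $(*)$, then $\mathcal L$ is singular if and only if $\omega$ is singular. If $n$ is finite, then all transfer operators for $(\mathcal B(H),\alpha)$ are normal. (iii) There is a unique non-degenerate transfer operator for $(\mathcal B(H),\alpha)$ if and only if $n=1$; in that case $\alpha(a)=UaU^*$, and the non-degenerate transfer operator is $\mathcal L(a)=U^*aU$, which is a complete transfer operator. -/

import Mathlib

open scoped ComplexOrder Topology NNReal
open Filter

/-! ### Transfer operators for endomorphisms of unital C*-algebras -/

section CStar

set_option linter.unusedSectionVars false

variable {A B : Type*} [CStarAlgebra A] [PartialOrder A] [StarOrderedRing A]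
  [CStarAlgebra B] [PartialOrder B] [StarOrderedRing B]

/-- A map between ordered algebras is positive if it maps positive elements to positive
elements. -/
def IsPositiveMap (T : A →L[ℂ] B) : Prop := ∀ a : A, 0 ≤ a → 0 ≤ T a

/-- `L` is a transfer operator for `(A, α)`: a continuous positive linear map such that
`L (α(a) b) = a L(b)`. -/
structure IsTransferOperator (α : A →⋆ₙₐ[ℂ] A) (L : A →L[ℂ] A) : Prop where
  positive : IsPositiveMap L
  transfer : ∀ a b : A, L (α a * b) = a * L b

/-- `E` is a conditional expectation of `A` onto the subalgebra with underlying set `S`: a positive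
contractive linear projection onto `S` that is an `S`-bimodule map. -/
structure IsConditionalExpectation (E : A →ₗ[ℂ] A) (S : Set A) : Prop where
  mem : ∀ a : A, E a ∈ S
  apply_of_mem : ∀ b ∈ S, E b = b
  positive : ∀ a : A, 0 ≤ a → 0 ≤ E a
  contractive : ∀ a : A, ‖E a‖ ≤ ‖a‖
  map_mul_left : ∀ b ∈ S, ∀ a : A, E (b * a) = b * E a
  map_mul_right : ∀ b ∈ S, ∀ a : A, E (a * b) = E a * b

/-- A transfer operator `L` is non-degenerate if `α ∘ L` is a conditional expectation of `A` onto
the range of `α` (equivalently `α ∘ L ∘ α = α`, equivalently `α (L 1) = α 1`). -/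
structure IsNonDegenerateTransferOperator (α : A →⋆ₙₐ[ℂ] A) (L : A →L[ℂ] A) : Prop where
  isTransferOperator : IsTransferOperator α L
  nonDegenerate :
    IsConditionalExpectation ((α : A →ₗ[ℂ] A) ∘ₗ (L : A →ₗ[ℂ] A)) (Set.range α)

/-- The kernel of `α` is a unital algebra (its unit `e` may be zero). -/
def HasUnitalKernel (α : A →⋆ₙₐ[ℂ] A) : Prop :=
  ∃ e : A, α e = 0 ∧ ∀ a : A, α a = 0 → e * a = a ∧ a * e = a

/-- The range of `α` is a hereditary subalgebra. -/
def HasHereditaryRange (α : A →⋆ₙₐ[ℂ] A) : Prop :=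
  ∀ b c : A, 0 ≤ b → b ≤ c → c ∈ Set.range α → b ∈ Set.range α

/-- `L` is a complete transfer operator: `α` has unital kernel and hereditary range, and `L a` is
the element of the annihilator of `ker α` that `α` maps to `α(1) a α(1)`. -/
structure IsCompleteTransferOperator (α : A →⋆ₙₐ[ℂ] A) (L : A →L[ℂ] A) : Prop where
  isTransferOperator : IsTransferOperator α L
  unitalKernel : HasUnitalKernel α
  hereditaryRange : HasHereditaryRange α
  mem_annihilator : ∀ a k : A, α k = 0 → L a * k = 0
  map_eq : ∀ a : A, α (L a) = α 1 * a * α 1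

/-- A map is normal if it preserves suprema of upward directed families of self-adjoint
elements. -/
def IsNormalMap (T : A →L[ℂ] B) : Prop :=
  ∀ D : Set A, D.Nonempty → DirectedOn (· ≤ ·) D → (∀ d ∈ D, IsSelfAdjoint d) →
    ∀ s : A, IsLUB D s → IsLUB (T '' D) (T s)

theorem IsPositiveMap.monotone {T : A →L[ℂ] B} (hT : IsPositiveMap T) : Monotone T := by
  intro a b hab
  have h := hT (b - a) (sub_nonneg.mpr hab)
  rwa [map_sub, sub_nonneg] at h

theorem IsPositiveMap.add {S T : A →L[ℂ] B} (hS : IsPositiveMap S) (hT : IsPositiveMap T) :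
    IsPositiveMap (S + T) := fun a ha => add_nonneg (hS a ha) (hT a ha)

theorem IsPositiveMap.smul {T : A →L[ℂ] B} (hT : IsPositiveMap T) {c : ℝ} (hc : 0 ≤ c) :
    IsPositiveMap (c • T) := by
  intro a ha
  have h : 0 ≤ c • T a := smul_nonneg hc (hT a ha)
  exact h

theorem IsNormalMap.zero : IsNormalMap (0 : A →L[ℂ] B) := by
  intro D hD _ _ s _
  obtain ⟨d, hd⟩ := hD
  refine ⟨?_, fun u hu => hu ⟨d, hd, rfl⟩⟩
  rintro _ ⟨x, _, rfl⟩
  exact le_refl _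

theorem IsNormalMap.add {S T : A →L[ℂ] B} (hS : IsNormalMap S) (hT : IsNormalMap T)
    (pS : IsPositiveMap S) (pT : IsPositiveMap T) : IsNormalMap (S + T) := by
  intro D hD dD sD s hs
  have h1 := hS D hD dD sD s hs
  have h2 := hT D hD dD sD s hs
  refine ⟨?_, fun u hu => ?_⟩
  · rintro _ ⟨d, hd, rfl⟩
    exact add_le_add (h1.1 ⟨d, hd, rfl⟩) (h2.1 ⟨d, hd, rfl⟩)
  · have key : ∀ d ∈ D, ∀ d' ∈ D, S d + T d' ≤ u := by
      intro d hd d' hd'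
      obtain ⟨e, he, hde, hde'⟩ := dD d hd d' hd'
      exact (add_le_add (pS.monotone hde) (pT.monotone hde')).trans (hu ⟨e, he, rfl⟩)
    have h3 : ∀ d' ∈ D, S s ≤ u - T d' := by
      intro d' hd'
      refine h1.2 ?_
      rintro _ ⟨d, hd, rfl⟩
      exact le_sub_iff_add_le.mpr (key d hd d' hd')
    have h4 : T s ≤ u - S s := by
      refine h2.2 ?_
      rintro _ ⟨d', hd', rfl⟩
      exact le_sub_comm.mp (h3 d' hd')
    exact le_sub_iff_add_le'.mp h4

theorem IsNormalMap.smul {T : A →L[ℂ] B} (hT : IsNormalMap T) {c : ℝ} (hc : 0 ≤ c) :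
    IsNormalMap (c • T) := by
  rcases hc.eq_or_lt with rfl | hc
  · have h0 : (0 : ℝ) • T = 0 := zero_smul ℝ T
    rw [h0]
    exact IsNormalMap.zero
  intro D hD dD sD s hs
  have h1 := hT D hD dD sD s hs
  refine ⟨?_, fun u hu => ?_⟩
  · rintro _ ⟨d, hd, rfl⟩
    have h2 : c • T d ≤ c • T s := smul_le_smul_of_nonneg_left (h1.1 ⟨d, hd, rfl⟩) hc.le
    exact h2
  · have h2 : T s ≤ c⁻¹ • u := by
      refine h1.2 ?_
      rintro _ ⟨d, hd, rfl⟩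
      have h3 : c • T d ≤ u := hu ⟨d, hd, rfl⟩
      have h4 := smul_le_smul_of_nonneg_left h3 (inv_nonneg.mpr hc.le)
      rwa [inv_smul_smul₀ hc.ne'] at h4
    have h5 := smul_le_smul_of_nonneg_left h2 hc.le
    rwa [smul_inv_smul₀ hc.ne'] at h5

/-- The cone of normal transfer operators for `(A, α)`. -/
def normalTransferCone (α : A →⋆ₙₐ[ℂ] A) : PointedCone ℝ (A →L[ℂ] A) where
  carrier := {L | IsTransferOperator α L ∧ IsNormalMap L}
  add_mem' := by
    rintro S T ⟨hS, nS⟩ ⟨hT, nT⟩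
    exact ⟨⟨hS.positive.add hT.positive, fun a b => by
      simp [hS.transfer, hT.transfer, mul_add]⟩, nS.add nT hS.positive hT.positive⟩
  zero_mem' := ⟨⟨fun _ _ => le_refl _, fun a b => by simp⟩, IsNormalMap.zero⟩
  smul_mem' := by
    rintro ⟨c, hc⟩ T ⟨hT, nT⟩
    exact ⟨⟨hT.positive.smul hc, fun a b => by
      change c • T (α a * b) = a * (c • T b)
      rw [hT.transfer, mul_smul_comm]⟩, nT.smul hc⟩

variable (A) in
/-- The cone of normal positive linear functionals on `A`. -/
def normalFunctionalCone : PointedCone ℝ (A →L[ℂ] ℂ) where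
  carrier := {ω | IsPositiveMap ω ∧ IsNormalMap ω}
  add_mem' := by
    rintro S T ⟨hS, nS⟩ ⟨hT, nT⟩
    exact ⟨hS.add hT, nS.add nT hS hT⟩
  zero_mem' := ⟨fun _ _ => le_refl _, IsNormalMap.zero⟩
  smul_mem' := by
    rintro ⟨c, hc⟩ T ⟨hT, nT⟩
    exact ⟨hT.smul hc, nT.smul hc⟩

end CStar

/-! ### Endomorphisms of `B(H)` -/

section Hilbert

variable {H K : Type*} [NormedAddCommGroup H] [InnerProductSpace ℂ H] [CompleteSpace H]
  [NormedAddCommGroup K] [InnerProductSpace ℂ K] [CompleteSpace K]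

/-- A map on `B(H)` is singular if it annihilates the compact operators. -/
def IsSingularMap {B : Type*} [AddCommMonoid B] [TopologicalSpace B] [Module ℂ B]
    (T : (H →L[ℂ] H) →L[ℂ] B) : Prop :=
  ∀ a : H →L[ℂ] H, IsCompactOperator a → T a = 0

/-- An index set with `n` elements, `n = 0, 1, 2, …, ∞`. -/
abbrev IndexSet (n : ℕ∞) : Type := {i : ℕ // (i : ℕ∞) < n}

/-- The `U i` are isometries with mutually orthogonal ranges such that
`α(a) = ∑ i, U i a (U i)*`, the sum being weakly convergent. -/
structure IsImplementedBy {n : ℕ∞} (α : (H →L[ℂ] H) →⋆ₙₐ[ℂ] (H →L[ℂ] H))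
    (U : IndexSet n → (H →L[ℂ] H)) : Prop where
  isometry : ∀ i, Isometry (U i)
  orthogonal : ∀ i j, i ≠ j → ∀ x y : H, inner ℂ (U i x) (U j y) = 0
  hasSum : ∀ (a : H →L[ℂ] H) (x y : H),
    HasSum (fun i => inner ℂ x ((U i * a * star (U i)) y)) (inner ℂ x (α a y))

/-- `B(H₀)` with `H₀ = U₀ H`, regarded as the corner `P B(H) P` of `B(H)`, where `P = U₀ U₀*`
is the projection onto `H₀`. -/
def cornerAlgebra (U₀ : H →L[ℂ] H) : Set (H →L[ℂ] H) :=
  {a | (U₀ * star U₀) * a * (U₀ * star U₀) = a}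

/-- The operator `T` is the weakly convergent sum `∑ i j, b(i,j) U_i (U₀* a U₀) U_j*`, where
`U₀ = U i₀` and `b(i,j) = ⟨b e_j, e_i⟩` is the matrix of `b` in the orthonormal basis `e`. -/
def IsElementaryTensor {n : ℕ∞} (U : IndexSet n → (H →L[ℂ] H)) (i₀ : IndexSet n)
    (e : HilbertBasis (IndexSet n) ℂ K) (a : H →L[ℂ] H) (b : K →L[ℂ] K) (T : H →L[ℂ] H) : Prop :=
  ∀ x y : H, Tendsto
    (fun F : Finset (IndexSet n) => ∑ i ∈ F, ∑ j ∈ F,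
      inner ℂ (e i) (b (e j)) * inner ℂ x ((U i * (star (U i₀) * a * U i₀) * star (U j)) y))
    atTop (𝓝 (inner ℂ x (T y)))

open Classical in
/-- The operator `a ⊗ b`, the sum of the weakly convergent series above. -/
noncomputable def elementaryTensor {n : ℕ∞} (U : IndexSet n → (H →L[ℂ] H)) (i₀ : IndexSet n)
    (e : HilbertBasis (IndexSet n) ℂ K) (a : H →L[ℂ] H) (b : K →L[ℂ] K) : H →L[ℂ] H :=
  if h : ∃ T, IsElementaryTensor U i₀ e a b T then h.choose else 0

/-- The relation `L(a ⊗ b) = ω(b) U₀* a U₀` for all `a ∈ B(H₀)` and `b ∈ B(K)`, where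
`U₀ = U i₀`. -/
def IsTensorRelated {n : ℕ∞} (U : IndexSet n → (H →L[ℂ] H)) (i₀ : IndexSet n)
    (e : HilbertBasis (IndexSet n) ℂ K) (L : (H →L[ℂ] H) →L[ℂ] (H →L[ℂ] H))
    (ω : (K →L[ℂ] K) →L[ℂ] ℂ) : Prop :=
  ∀ a ∈ cornerAlgebra (U i₀), ∀ b : K →L[ℂ] K,
    L (elementaryTensor U i₀ e a b) = ω b • (star (U i₀) * a * U i₀)

end Hilbert

/-! Write `K` for H_n and let J_ξ : K → H be the column e_i ↦ U_i ξ. Since ⟨J_ξ η, J_ξ' η'⟩ = ⟨ξ,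
ξ'⟩⟨η, η'⟩, the range of α(1) is a copy of H ⊗ K in which J_ξ η is ξ ⊗ η, α(c) is c ⊗ 1, and U_i c
U_j* is c ⊗ e_ij. The defining series of a ⊗ b sums to α(c)(1 ⊗ b) with c = U*aU.

A transfer operator is a bimodule map over α, its right-hand identity coming from adjoints. As 1 ⊗ b
commutes with every α(c), L(1 ⊗ b) commutes with all of B(H) and is a scalar ω(b); this gives (∗)
(`map_mul_commutant_eq`). Conversely ⟨ξ, L(x)η⟩ = ω(J_ξ* x J_η) defines a slice map for every
bounded ω, with the norm of ω (`norm_ofFunctional`).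

For normal L the identity α(1) = ∑ U_i U_i* may be inserted on both sides of x, by Cauchy–Schwarz
for the functionals ⟨ξ, L(·)ξ⟩. Hence L is determined by its values on U_i c U_j*, that is by ω
(`eq_of_isNormalMap`), and slicing inverts L ↦ ω. The same insertion converges in norm for compact
x, which gives the statement on singularity, and is a finite sum when n is finite, which gives
normality.

Each U_i*(·)U_i is a non-degenerate transfer operator, and these differ for different i, so
uniqueness forces n = 1. If n = 1, then α(1)xα(1) = α(U*xU), which determines L.

The isometries exist because the operators α(|x⟩⟨ξ|) carry an orthonormal basis of the range of
α(|ξ⟩⟨ξ|) to the desired ranges. What remains is a representation vanishing on rank-one operators;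
on a separable space it is zero, because an uncountable almost disjoint family of subsets of ℕ would
otherwise yield uncountably many orthonormal vectors. -/

/-! ### Isometries with orthogonal ranges: Bessel's inequality and ampliations. -/

section OrthogonalIsometries

set_option linter.unusedSectionVars false

variable {ι G H : Type*} [NormedAddCommGroup G] [InnerProductSpace ℂ G] [CompleteSpace G]
  [NormedAddCommGroup H] [InnerProductSpace ℂ H] [CompleteSpace H]

/-- A family of isometries with mutually orthogonal ranges. -/
structure IsOrthogonalIsometryFamily (V : ι → (G →L[ℂ] H)) : Prop where
  isometry : ∀ i, Isometry (V i)
  orthogonal : ∀ i j, i ≠ j → ∀ x y : G, inner ℂ (V i x) (V j y) = 0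

namespace IsOrthogonalIsometryFamily

variable {V : ι → (G →L[ℂ] H)} (hV : IsOrthogonalIsometryFamily V)
include hV

theorem norm_apply (i : ι) (x : G) : ‖V i x‖ = ‖x‖ :=
  (AddMonoidHomClass.isometry_iff_norm (V i)).mp (hV.isometry i) x

theorem inner_apply_self (i : ι) (x y : G) : inner ℂ (V i x) (V i y) = inner ℂ x y :=
  LinearIsometry.inner_map_map ⟨(V i).toLinearMap, hV.norm_apply i⟩ x y

theorem adjoint_apply_self (i : ι) (x : G) : (V i).adjoint (V i x) = x := by
  refine ext_inner_left ℂ fun y => ?_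
  rw [ContinuousLinearMap.adjoint_inner_right, hV.inner_apply_self]

theorem adjoint_apply_of_ne {i j : ι} (hij : i ≠ j) (x : G) : (V i).adjoint (V j x) = 0 := by
  refine ext_inner_left ℂ fun y => ?_
  rw [ContinuousLinearMap.adjoint_inner_right, hV.orthogonal i j hij, inner_zero_right]

theorem orthogonalFamily :
    OrthogonalFamily ℂ (fun _ : ι => G)
      fun i => (⟨(V i).toLinearMap, hV.norm_apply i⟩ : G →ₗᵢ[ℂ] H) :=
  fun i j hij x y => hV.orthogonal i j hij x y

/-- Bessel's inequality. With z = ∑ V_i V_i* y over `F`, both ‖z‖² and ⟨z, y⟩ equal the left-hand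
side, so Cauchy–Schwarz gives the bound. -/
theorem sum_norm_sq_adjoint_le (y : H) (F : Finset ι) :
    ∑ i ∈ F, ‖(V i).adjoint y‖ ^ 2 ≤ ‖y‖ ^ 2 := by
  classical
  set s := ∑ i ∈ F, ‖(V i).adjoint y‖ ^ 2 with hs
  have hz : ‖∑ i ∈ F, V i ((V i).adjoint y)‖ ^ 2 = s :=
    hV.orthogonalFamily.norm_sum (fun i => (V i).adjoint y) F
  have hi : inner ℂ (∑ i ∈ F, V i ((V i).adjoint y)) y = (s : ℂ) := by
    rw [sum_inner, hs]
    push_cast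
    refine Finset.sum_congr rfl fun i _ => ?_
    rw [← ContinuousLinearMap.adjoint_inner_right, inner_self_eq_norm_sq_to_K]
    rfl
  have h0 : 0 ≤ s := Finset.sum_nonneg fun _ _ => by positivity
  have h1 : s ≤ ‖∑ i ∈ F, V i ((V i).adjoint y)‖ * ‖y‖ := by
    have := norm_inner_le_norm (𝕜 := ℂ) (∑ i ∈ F, V i ((V i).adjoint y)) y
    rwa [hi, Complex.norm_real, Real.norm_of_nonneg h0] at this
  nlinarith [norm_nonneg (∑ i ∈ F, V i ((V i).adjoint y)), norm_nonneg y,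
    sq_nonneg (‖∑ i ∈ F, V i ((V i).adjoint y)‖ - ‖y‖)]

theorem summable_norm_sq_adjoint (y : H) : Summable fun i => ‖(V i).adjoint y‖ ^ 2 :=
  summable_of_sum_le (fun _ => by positivity) (hV.sum_norm_sq_adjoint_le y)

theorem summable_apply {f : ι → G} (hf : Summable fun i => ‖f i‖ ^ 2) :
    Summable fun i => V i (f i) :=
  (hV.orthogonalFamily.summable_iff_norm_sq_summable f).mpr hf

theorem norm_sq_le_of_hasSum {f : ι → G} {y : H} {c : ℝ} (hy : HasSum (fun i => V i (f i)) y)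
    (hc : ∀ F : Finset ι, ∑ i ∈ F, ‖f i‖ ^ 2 ≤ c) : ‖y‖ ^ 2 ≤ c := by
  refine le_of_tendsto ((continuous_norm.pow 2).tendsto y |>.comp hy) (.of_forall fun F => ?_)
  exact (hV.orthogonalFamily.norm_sum f F).trans_le (hc F)

theorem summable_ampliation (b : G →L[ℂ] G) (y : H) :
    Summable fun i => V i (b ((V i).adjoint y)) := by
  refine hV.summable_apply <|
    .of_nonneg_of_le (fun _ => by positivity) (fun i => ?_)
      ((hV.summable_norm_sq_adjoint y).mul_left (‖b‖ ^ 2))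
  rw [← mul_pow]
  gcongr
  exact b.le_opNorm _

theorem adjoint_apply_of_hasSum {f : ι → G} {y : H} (hy : HasSum (fun i => V i (f i)) y)
    (i : ι) : (V i).adjoint y = f i := by
  have h := (V i).adjoint.hasSum hy
  have h2 := hasSum_single (f := fun j => (V i).adjoint (V j (f j))) i fun j hj =>
    hV.adjoint_apply_of_ne hj.symm _
  rw [h.unique h2, hV.adjoint_apply_self]

/-- The operator `∑ i, V i b (V i)*`, a strongly convergent sum. -/
theorem exists_ampliation (b : G →L[ℂ] G) :
    ∃ T : H →L[ℂ] H, ∀ y, HasSum (fun i => V i (b ((V i).adjoint y))) (T y) := by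
  have hs := fun y => (hV.summable_ampliation b y).hasSum
  let T : H →ₗ[ℂ] H :=
    { toFun := fun y => ∑' i, V i (b ((V i).adjoint y))
      map_add' := fun x y => by
        refine (hs (x + y)).unique ?_
        simpa only [map_add] using (hs x).add (hs y)
      map_smul' := fun c y => by
        refine (hs (c • y)).unique ?_
        simpa only [map_smul, RingHom.id_apply] using (hs y).const_smul c }
  refine ⟨T.mkContinuous ‖b‖ fun y => ?_, hs⟩
  refine le_of_sq_le_sq ?_ (by positivity)
  refine hV.norm_sq_le_of_hasSum (hs y) fun F => ?_
  rw [mul_pow]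
  refine le_trans ?_ (mul_le_mul_of_nonneg_left (hV.sum_norm_sq_adjoint_le y F) (by positivity))
  rw [Finset.mul_sum]
  refine Finset.sum_le_sum fun i _ => ?_
  rw [← mul_pow]
  gcongr
  exact b.le_opNorm _

end IsOrthogonalIsometryFamily

end OrthogonalIsometries

/-! ### The columns J_ξ, a copy of H ⊗ K inside H. -/

section ColumnMap

set_option linter.unusedSectionVars false

variable {ι H K : Type*} [NormedAddCommGroup H] [InnerProductSpace ℂ H] [CompleteSpace H]
  [NormedAddCommGroup K] [InnerProductSpace ℂ K] [CompleteSpace K]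

namespace IsOrthogonalIsometryFamily

variable {U : ι → (H →L[ℂ] H)} (hU : IsOrthogonalIsometryFamily U) (e : HilbertBasis ι ℂ K)
include hU

theorem summable_column (ξ : H) (η : K) : Summable fun i => U i (inner ℂ (e i) η • ξ) := by
  refine hU.summable_apply ?_
  have h := (e.summable_inner_mul_inner η η).norm.mul_right (‖ξ‖ ^ 2)
  refine h.congr fun i => ?_
  rw [norm_smul, mul_pow, norm_mul, norm_inner_symm η (e i), sq ‖inner ℂ (e i) η‖]

theorem norm_column_le (ξ : H) (η : K) :
    ‖∑' i, U i (inner ℂ (e i) η • ξ)‖ ≤ 1 * ‖ξ‖ * ‖η‖ := by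
  refine le_of_sq_le_sq ?_ (by positivity)
  refine hU.norm_sq_le_of_hasSum (hU.summable_column e ξ η).hasSum fun F => ?_
  have h := e.orthonormal.sum_inner_products_le (s := F) η
  calc ∑ i ∈ F, ‖inner ℂ (e i) η • ξ‖ ^ 2 = (∑ i ∈ F, ‖inner ℂ (e i) η‖ ^ 2) * ‖ξ‖ ^ 2 := by
        rw [Finset.sum_mul]
        exact Finset.sum_congr rfl fun i _ => by rw [norm_smul, mul_pow]
    _ ≤ ‖η‖ ^ 2 * ‖ξ‖ ^ 2 := by gcongr
    _ = (1 * ‖ξ‖ * ‖η‖) ^ 2 := by ring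

/-- The operators `K → H` indexed by `ξ : H` that map the basis vector `e i` to `U i ξ`. -/
noncomputable def columnMap : H →L[ℂ] K →L[ℂ] H :=
  LinearMap.mkContinuous₂
    (LinearMap.mk₂ ℂ (fun ξ η => ∑' i, U i (inner ℂ (e i) η • ξ))
      (fun ξ ξ' η => by
        refine (hU.summable_column e (ξ + ξ') η).hasSum.unique ?_
        simpa only [smul_add, map_add] using
          (hU.summable_column e ξ η).hasSum.add (hU.summable_column e ξ' η).hasSum)
      (fun c ξ η => by
        refine (hU.summable_column e (c • ξ) η).hasSum.unique ?_
        simpa only [map_smul, smul_comm c] using (hU.summable_column e ξ η).hasSum.const_smul c)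
      (fun ξ η η' => by
        refine (hU.summable_column e ξ (η + η')).hasSum.unique ?_
        simpa only [inner_add_right, add_smul, map_add] using
          (hU.summable_column e ξ η).hasSum.add (hU.summable_column e ξ η').hasSum)
      (fun c ξ η => by
        refine (hU.summable_column e ξ (c • η)).hasSum.unique ?_
        simpa only [inner_smul_right, mul_smul, map_smul] using
          (hU.summable_column e ξ η).hasSum.const_smul c))
    1 (hU.norm_column_le e)

theorem hasSum_columnMap (ξ : H) (η : K) :
    HasSum (fun i => U i (inner ℂ (e i) η • ξ)) (hU.columnMap e ξ η) :=
  (hU.summable_column e ξ η).hasSum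

theorem norm_columnMap_le (ξ : H) : ‖hU.columnMap e ξ‖ ≤ ‖ξ‖ :=
  ContinuousLinearMap.opNorm_le_bound _ (norm_nonneg _) fun η =>
    (hU.norm_column_le e ξ η).trans_eq (by rw [one_mul])

theorem adjoint_columnMap (i : ι) (ξ : H) (η : K) :
    (U i).adjoint (hU.columnMap e ξ η) = inner ℂ (e i) η • ξ :=
  hU.adjoint_apply_of_hasSum (hU.hasSum_columnMap e ξ η) i

theorem columnMap_basis (ξ : H) (i : ι) : hU.columnMap e ξ (e i) = U i ξ := by
  classical
  have h := hasSum_single (f := fun j => U j (inner ℂ (e j) (e i) • ξ)) i fun j hj => by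
    rw [e.orthonormal.2 hj, zero_smul, map_zero]
  rw [(hU.hasSum_columnMap e ξ (e i)).unique h, inner_self_eq_norm_sq_to_K, e.orthonormal.1 i]
  simp

/-- Parseval's identity in the basis `e`. This is the inner product of elementary tensors ξ ⊗ η. -/
theorem inner_columnMap (ξ ξ' : H) (η η' : K) :
    inner ℂ (hU.columnMap e ξ η) (hU.columnMap e ξ' η') = inner ℂ ξ ξ' * inner ℂ η η' := by
  have h := (innerSL ℂ (hU.columnMap e ξ η)).hasSum (hU.hasSum_columnMap e ξ' η')
  refine h.unique ?_
  refine ((e.hasSum_inner_mul_inner η η').mul_left (inner ℂ ξ ξ')).congr_fun fun i => ?_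
  rw [innerSL_apply_apply, ← ContinuousLinearMap.adjoint_inner_left,
    hU.adjoint_columnMap, inner_smul_left, inner_smul_right, inner_conj_symm]
  ring

theorem adjoint_columnMap_columnMap (ξ ξ' : H) (η : K) :
    (hU.columnMap e ξ).adjoint (hU.columnMap e ξ' η) = inner ℂ ξ ξ' • η := by
  refine ext_inner_left ℂ fun η' => ?_
  rw [ContinuousLinearMap.adjoint_inner_right, hU.inner_columnMap, inner_smul_right]

/-- The tensor product read from its other factor: these isometries K → H serve to ampliate
operators on `K`. -/
theorem columnMap_family {κ : Type*} {g : κ → H} (hg : Orthonormal ℂ g) :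
    IsOrthogonalIsometryFamily fun k => hU.columnMap e (g k) where
  isometry k := by
    refine (AddMonoidHomClass.isometry_iff_norm _).mpr fun η => ?_
    rw [@norm_eq_sqrt_re_inner ℂ, hU.inner_columnMap, inner_self_eq_norm_sq_to_K, hg.1 k,
      @norm_eq_sqrt_re_inner ℂ _ _ _ _ η]
    simp
  orthogonal k l hkl x y := by rw [hU.inner_columnMap, hg.2 hkl, zero_mul]

end IsOrthogonalIsometryFamily

end ColumnMap

/-! ### The operators α(c) = c ⊗ 1 and 1 ⊗ b, and the sum of the tensor series. -/

section Implemented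

set_option linter.unusedSectionVars false

variable {H K : Type*} [NormedAddCommGroup H] [InnerProductSpace ℂ H] [CompleteSpace H]
  [NormedAddCommGroup K] [InnerProductSpace ℂ K] [CompleteSpace K]

namespace IsImplementedBy

variable {n : ℕ∞} {α : (H →L[ℂ] H) →⋆ₙₐ[ℂ] (H →L[ℂ] H)} {U : IndexSet n → (H →L[ℂ] H)}
  (hα : IsImplementedBy α U)
include hα

theorem family : IsOrthogonalIsometryFamily U := ⟨hα.isometry, hα.orthogonal⟩

theorem hasSum_apply (a : H →L[ℂ] H) (y : H) :
    HasSum (fun i => U i (a ((U i).adjoint y))) (α a y) := by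
  obtain ⟨T, hT⟩ := hα.family.exists_ampliation a
  convert hT y using 1
  refine ext_inner_left ℂ fun x => ?_
  exact (hα.hasSum a x y).unique ((innerSL ℂ x).hasSum (hT y))

theorem map_apply_isometry (a : H →L[ℂ] H) (i : IndexSet n) (x : H) :
    α a (U i x) = U i (a x) := by
  have h := hasSum_single (f := fun j => U j (a ((U j).adjoint (U i x)))) i fun j hj => by
    rw [hα.family.adjoint_apply_of_ne hj, map_zero, map_zero]
  rw [(hα.hasSum_apply a (U i x)).unique h, hα.family.adjoint_apply_self]

theorem adjoint_map_apply (a : H →L[ℂ] H) (i : IndexSet n) (x : H) :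
    (U i).adjoint (α a x) = a ((U i).adjoint x) :=
  hα.family.adjoint_apply_of_hasSum (hα.hasSum_apply a x) i

theorem hasSum_map_one (y : H) : HasSum (fun i => U i ((U i).adjoint y)) (α 1 y) :=
  hα.hasSum_apply 1 y

variable (e : HilbertBasis (IndexSet n) ℂ K)

theorem map_columnMap (a : H →L[ℂ] H) (ξ : H) (η : K) :
    α a (hα.family.columnMap e ξ η) = hα.family.columnMap e (a ξ) η := by
  refine ((α a).hasSum (hα.family.hasSum_columnMap e ξ η)).unique ?_
  convert hα.family.hasSum_columnMap e (a ξ) η using 2 with i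
  rw [hα.map_apply_isometry, map_smul]

theorem map_rankOne (ξ ξ' : H) :
    α (InnerProductSpace.rankOne ℂ ξ ξ') =
      hα.family.columnMap e ξ ∘L (hα.family.columnMap e ξ').adjoint := by
  ext y
  refine (hα.hasSum_apply _ y).unique ?_
  rw [ContinuousLinearMap.comp_apply]
  convert hα.family.hasSum_columnMap e ξ ((hα.family.columnMap e ξ').adjoint y) using 2 with i
  rw [ContinuousLinearMap.adjoint_inner_right, hα.family.columnMap_basis,
    InnerProductSpace.rankOne_apply, ContinuousLinearMap.adjoint_inner_right]

/-- The operator `1 ⊗ b`, the unique operator on the range of `α 1` that intertwines `b` and itself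
along the columns. -/
theorem exists_commutant (b : K →L[ℂ] K) :
    ∃ B : H →L[ℂ] H, (∀ ξ η, B (hα.family.columnMap e ξ η) = hα.family.columnMap e ξ (b η)) ∧
      B * α 1 = B := by
  obtain ⟨w, g, -⟩ := exists_hilbertBasis ℂ H
  have hJ := hα.family.columnMap_family e g.orthonormal
  -- In a basis g of H, 1 ⊗ b is the strong sum of J_{g_k} b J_{g_k}*. Its action on J_ξ is checked
  -- for basis vectors ξ and extended by density.
  obtain ⟨B, hB⟩ := hJ.exists_ampliation b
  refine ⟨B, fun ξ η => ?_, ?_⟩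
  · have key : B ∘L (hα.family.columnMap e).flip η = (hα.family.columnMap e).flip (b η) := by
      refine ContinuousLinearMap.ext_on
        (Submodule.dense_iff_topologicalClosure_eq_top.mpr g.dense_span) ?_
      rintro _ ⟨l, rfl⟩
      refine (hB _).unique ?_
      have h := hasSum_single (f := fun k => hα.family.columnMap e (g k)
        (b ((hα.family.columnMap e (g k)).adjoint (hα.family.columnMap e (g l) η)))) l
        fun k hk => by rw [hJ.adjoint_apply_of_ne hk, map_zero, map_zero]
      rwa [hJ.adjoint_apply_self] at h
    exact DFunLike.congr_fun key ξ
  · ext y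
    refine (hB _).unique ?_
    convert hB y using 4 with k
    -- Each J_{g_k}* absorbs α(1), since α(1) fixes every column.
    refine ext_inner_left ℂ fun η => ?_
    have h1 : (α 1).adjoint = α 1 := by
      rw [← ContinuousLinearMap.star_eq_adjoint, ← map_star, star_one]
    rw [ContinuousLinearMap.adjoint_inner_right, ContinuousLinearMap.adjoint_inner_right]
    change inner ℂ _ (α 1 y) = _
    rw [← ContinuousLinearMap.adjoint_inner_left, h1, hα.map_columnMap]
    rfl

/-- The operator `1 ⊗ b`. -/
noncomputable def commutant (b : K →L[ℂ] K) : H →L[ℂ] H := (hα.exists_commutant e b).choose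

theorem commutant_columnMap (b : K →L[ℂ] K) (ξ : H) (η : K) :
    hα.commutant e b (hα.family.columnMap e ξ η) = hα.family.columnMap e ξ (b η) :=
  (hα.exists_commutant e b).choose_spec.1 ξ η

theorem commutant_mul_map_one (b : K →L[ℂ] K) : hα.commutant e b * α 1 = hα.commutant e b :=
  (hα.exists_commutant e b).choose_spec.2

/-- α(1) is the strong sum of U_i U_i*, so an operator that absorbs it on the right is determined on
the ranges of the U_i. -/
theorem ext_of_mul_map_one {S T : H →L[ℂ] H} (hS : S * α 1 = S) (hT : T * α 1 = T)
    (h : ∀ i x, S (U i x) = T (U i x)) : S = T := by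
  ext y
  have h1 := S.hasSum (hα.hasSum_map_one y)
  have h2 := T.hasSum (hα.hasSum_map_one y)
  simp only [h] at h1
  have h3 := h1.unique h2
  rwa [← mul_apply_eq_comp, ← mul_apply_eq_comp, hS, hT] at h3

theorem commutant_mul_map (b : K →L[ℂ] K) (c : H →L[ℂ] H) :
    hα.commutant e b * α c = α c * hα.commutant e b := by
  refine hα.ext_of_mul_map_one ?_ ?_ fun i x => ?_
  · rw [mul_assoc, ← map_mul, mul_one]
  · rw [mul_assoc, hα.commutant_mul_map_one]
  · change hα.commutant e b (α c (U i x)) = α c (hα.commutant e b (U i x))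
    rw [← hα.family.columnMap_basis e x i, hα.map_columnMap, hα.commutant_columnMap,
      hα.commutant_columnMap, hα.map_columnMap]

theorem map_rankOne_mul_commutant (b : K →L[ℂ] K) (ξ ξ' : H) :
    α (InnerProductSpace.rankOne ℂ ξ ξ') * hα.commutant e b =
      hα.family.columnMap e ξ ∘L b ∘L (hα.family.columnMap e ξ').adjoint := by
  rw [← hα.commutant_mul_map, hα.map_rankOne e]
  ext y
  exact hα.commutant_columnMap e b _ _

theorem adjoint_map_mul_commutant (b : K →L[ℂ] K) (c : H →L[ℂ] H) (i j : IndexSet n) (z : H) :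
    (U i).adjoint ((α c * hα.commutant e b) (U j z)) = inner ℂ (e i) (b (e j)) • c z := by
  rw [mul_apply_eq_comp, ← hα.family.columnMap_basis e z j, hα.commutant_columnMap,
    hα.map_columnMap, hα.family.adjoint_columnMap]

/-- With P_F = ∑ U_i U_i* over `F`, the partial sum is ⟨P_F x, T P_F y⟩. It converges because P_F →
α(1) strongly and T = α(1) T α(1). -/
theorem isElementaryTensor (i₀ : IndexSet n) (a : H →L[ℂ] H) (b : K →L[ℂ] K) :
    IsElementaryTensor U i₀ e a b (α (star (U i₀) * a * U i₀) * hα.commutant e b) := by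
  intro x y
  set c := star (U i₀) * a * U i₀
  set T := α c * hα.commutant e b with hT
  have h1 : (α 1).adjoint = α 1 := by
    rw [← ContinuousLinearMap.star_eq_adjoint, ← map_star, star_one]
  have h2 : inner ℂ x (T y) = inner ℂ (α 1 x) (T (α 1 y)) := by
    rw [← ContinuousLinearMap.adjoint_inner_right, h1]
    have : α 1 * T * α 1 = T := by
      rw [hT, mul_assoc, mul_assoc, hα.commutant_mul_map_one, ← mul_assoc, ← map_mul, one_mul]
    conv_lhs => rw [← this]
    rfl
  rw [h2]
  have hx : Tendsto (fun F : Finset (IndexSet n) => ∑ i ∈ F, U i ((U i).adjoint x)) atTop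
      (𝓝 (α 1 x)) := hα.hasSum_map_one x
  have hy : Tendsto (fun F : Finset (IndexSet n) => ∑ i ∈ F, U i ((U i).adjoint y)) atTop
      (𝓝 (α 1 y)) := hα.hasSum_map_one y
  refine (hx.inner ((T.continuous.tendsto _).comp hy)).congr fun F => ?_
  rw [Function.comp_apply, map_sum, sum_inner]
  refine Finset.sum_congr rfl fun i _ => ?_
  rw [inner_sum]
  refine Finset.sum_congr rfl fun j _ => ?_
  rw [← ContinuousLinearMap.adjoint_inner_right, hα.adjoint_map_mul_commutant, inner_smul_right,
    ContinuousLinearMap.adjoint_inner_left]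
  rfl

theorem elementaryTensor_eq (i₀ : IndexSet n) (a : H →L[ℂ] H) (b : K →L[ℂ] K) :
    elementaryTensor U i₀ e a b = α (star (U i₀) * a * U i₀) * hα.commutant e b := by
  have h : ∃ T, IsElementaryTensor U i₀ e a b T := ⟨_, hα.isElementaryTensor e i₀ a b⟩
  rw [elementaryTensor, dif_pos h]
  ext y
  refine ext_inner_left ℂ fun x => ?_
  exact tendsto_nhds_unique (h.choose_spec x y) (hα.isElementaryTensor e i₀ a b x y)

/-- Conjugation by U identifies the corner with B(H), with inverse c ↦ U c U*; in this form the
relation no longer depends on `i₀`. -/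
theorem isTensorRelated_iff (i₀ : IndexSet n) (L : (H →L[ℂ] H) →L[ℂ] (H →L[ℂ] H))
    (ω : (K →L[ℂ] K) →L[ℂ] ℂ) :
    IsTensorRelated U i₀ e L ω ↔
      ∀ (c : H →L[ℂ] H) (b : K →L[ℂ] K), L (α c * hα.commutant e b) = ω b • c := by
  have hU : star (U i₀) * U i₀ = 1 := by
    ext x
    exact hα.family.adjoint_apply_self i₀ x
  constructor
  · intro h c b
    have h1 : star (U i₀) * (U i₀ * c * star (U i₀)) * U i₀ = c := by
      calc _ = (star (U i₀) * U i₀) * c * (star (U i₀) * U i₀) := by noncomm_ring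
        _ = c := by rw [hU, one_mul, mul_one]
    have h2 := h (U i₀ * c * star (U i₀)) (by
      change (U i₀ * star (U i₀)) * (U i₀ * c * star (U i₀)) * (U i₀ * star (U i₀)) = _
      calc _ = U i₀ * (star (U i₀) * (U i₀ * c * star (U i₀)) * U i₀) * star (U i₀) := by
            noncomm_ring
        _ = _ := by rw [h1]) b
    rwa [hα.elementaryTensor_eq, h1] at h2
  · intro h a _ b
    rw [hα.elementaryTensor_eq, h]

end IsImplementedBy

end Implemented

/-! ### Positive maps: adjoints, Cauchy–Schwarz, the two-sided transfer identity. -/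

section PositiveMaps

set_option linter.unusedSectionVars false

variable {A B : Type*} [CStarAlgebra A] [PartialOrder A] [StarOrderedRing A]
  [CStarAlgebra B] [PartialOrder B] [StarOrderedRing B]

theorem IsPositiveMap.map_star {T : A →L[ℂ] B} (hT : IsPositiveMap T) (a : A) :
    T (star a) = star (T a) :=
  StarHomClass.map_star (PositiveLinearMap.mk₀ (T : A →ₗ[ℂ] B) hT) a

/-- Cauchy–Schwarz for the GNS semi-inner product of φ. -/
theorem IsPositiveMap.norm_sq_apply_le {φ : A →L[ℂ] ℂ} (hφ : IsPositiveMap φ) (a b : A) :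
    ‖φ (star a * b)‖ ^ 2 ≤ ‖φ (star a * a)‖ * ‖φ (star b * b)‖ := by
  let f := PositiveLinearMap.mk₀ (φ : A →ₗ[ℂ] ℂ) hφ
  have h := norm_inner_le_norm (𝕜 := ℂ) (f.toPreGNS a) (f.toPreGNS b)
  have h2 : ∀ c : A, ‖f.toPreGNS c‖ ^ 2 = ‖φ (star c * c)‖ := fun c => by
    have h3 := congrArg norm (f.preGNS_norm_sq (f.toPreGNS c))
    rw [norm_pow, Complex.norm_real, norm_norm] at h3
    exact h3
  calc ‖φ (star a * b)‖ ^ 2 ≤ (‖f.toPreGNS a‖ * ‖f.toPreGNS b‖) ^ 2 := by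
        gcongr
        exact h
    _ = _ := by rw [mul_pow, h2, h2]

namespace IsTransferOperator

variable {α : A →⋆ₙₐ[ℂ] A} {L : A →L[ℂ] A} (hL : IsTransferOperator α L)
include hL

theorem transfer_right (a b : A) : L (b * α a) = L b * a := by
  have h := hL.transfer (star a) (star b)
  rw [map_star α, ← star_mul, hL.positive.map_star, hL.positive.map_star] at h
  simpa using congrArg star h

theorem map_one_mul (b : A) : L (α 1 * b) = L b := by rw [hL.transfer, one_mul]

theorem mul_map_one (b : A) : L (b * α 1) = L b := by rw [hL.transfer_right, mul_one]

end IsTransferOperator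

end PositiveMaps

/-! ### Positivity in B(H), two-sided compressions, vector functionals. -/

section Sandwich

set_option linter.unusedSectionVars false

variable {H K : Type*} [NormedAddCommGroup H] [InnerProductSpace ℂ H] [CompleteSpace H]
  [NormedAddCommGroup K] [InnerProductSpace ℂ K] [CompleteSpace K]

theorem nonneg_iff_inner {T : H →L[ℂ] H} : 0 ≤ T ↔ ∀ ξ, 0 ≤ inner ℂ ξ (T ξ) := by
  rw [ContinuousLinearMap.nonneg_iff_isPositive]
  refine ⟨fun h ξ => h.inner_nonneg_right ξ, fun h => ?_⟩
  rw [ContinuousLinearMap.isPositive_iff_complex]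
  intro ξ
  have h1 : inner ℂ (T ξ) ξ = inner ℂ ξ (T ξ) := by
    rw [← inner_conj_symm]
    exact Complex.conj_eq_iff_im.mpr (Complex.nonneg_iff.mp (h ξ)).2.symm
  obtain ⟨h2, h3⟩ := Complex.nonneg_iff.mp (h ξ)
  rw [h1]
  exact ⟨Complex.ext rfl h3, h2⟩

/-- The map `b ↦ S b T` as a bounded linear map. -/
noncomputable def sandwich (S : K →L[ℂ] H) (T : H →L[ℂ] K) :
    (K →L[ℂ] K) →L[ℂ] (H →L[ℂ] H) :=
  ContinuousLinearMap.compL ℂ H K H S ∘L (ContinuousLinearMap.compL ℂ H K K).flip T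

theorem sandwich_apply (S : K →L[ℂ] H) (T : H →L[ℂ] K) (b : K →L[ℂ] K) :
    sandwich S T b = S ∘L b ∘L T := rfl

theorem norm_sandwich_le (S : K →L[ℂ] H) (T : H →L[ℂ] K) (b : K →L[ℂ] K) :
    ‖sandwich S T b‖ ≤ ‖S‖ * ‖b‖ * ‖T‖ := by
  rw [sandwich_apply, mul_assoc]
  exact (S.opNorm_comp_le _).trans
    (mul_le_mul_of_nonneg_left (b.opNorm_comp_le _) (norm_nonneg _))

theorem isPositiveMap_sandwich (S : K →L[ℂ] H) : IsPositiveMap (sandwich S S.adjoint) :=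
  fun b hb => (ContinuousLinearMap.nonneg_iff_isPositive _).mpr
    (((ContinuousLinearMap.nonneg_iff_isPositive b).mp hb).conj_adjoint S)

theorem isPositiveMap_sandwich_adjoint (S : K →L[ℂ] H) : IsPositiveMap (sandwich S.adjoint S) :=
  fun b hb => (ContinuousLinearMap.nonneg_iff_isPositive _).mpr
    (((ContinuousLinearMap.nonneg_iff_isPositive b).mp hb).adjoint_conj S)

/-- The map `T ↦ ⟨x, T y⟩` as a bounded linear functional. -/
noncomputable def vectorFunctional (x y : H) : (H →L[ℂ] H) →L[ℂ] ℂ :=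
  innerSL ℂ x ∘L ContinuousLinearMap.apply ℂ H y

theorem vectorFunctional_apply (x y : H) (T : H →L[ℂ] H) :
    vectorFunctional x y T = inner ℂ x (T y) := rfl

theorem isPositiveMap_vectorFunctional (x : H) : IsPositiveMap (vectorFunctional x x) :=
  fun b hb => ((ContinuousLinearMap.nonneg_iff_isPositive b).mp hb).inner_nonneg_right x

theorem IsPositiveMap.comp {A B C : Type*} [CStarAlgebra A] [PartialOrder A] [StarOrderedRing A]
    [CStarAlgebra B] [PartialOrder B] [StarOrderedRing B] [CStarAlgebra C] [PartialOrder C]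
    [StarOrderedRing C] {S : B →L[ℂ] C} {T : A →L[ℂ] B} (hS : IsPositiveMap S)
    (hT : IsPositiveMap T) : IsPositiveMap (S ∘L T) := fun a ha => hS _ (hT a ha)

/-- Evaluating the commutation with |x⟩⟨ξ| at ξ gives ⟨ξ, zξ⟩ x = z x. -/
theorem eq_smul_one_of_commute {z : H →L[ℂ] H} (hz : ∀ c : H →L[ℂ] H, c * z = z * c) {ξ : H}
    (hξ : ‖ξ‖ = 1) : z = (inner ℂ ξ (z ξ)) • (1 : H →L[ℂ] H) := by
  ext x
  have h := DFunLike.congr_fun (hz (InnerProductSpace.rankOne ℂ x ξ)) ξ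
  rw [mul_apply_eq_comp, mul_apply_eq_comp, InnerProductSpace.rankOne_apply,
    InnerProductSpace.rankOne_apply, inner_self_eq_norm_sq_to_K, hξ] at h
  simpa using h.symm

end Sandwich

/-! ### From transfer operators to functionals, and back by slicing. -/

section Correspondence

set_option linter.unusedSectionVars false

variable {H K : Type*} [NormedAddCommGroup H] [InnerProductSpace ℂ H] [CompleteSpace H]
  [NormedAddCommGroup K] [InnerProductSpace ℂ K] [CompleteSpace K]

namespace IsImplementedBy

variable {n : ℕ∞} {α : (H →L[ℂ] H) →⋆ₙₐ[ℂ] (H →L[ℂ] H)} {U : IndexSet n → (H →L[ℂ] H)}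
  (hα : IsImplementedBy α U) (e : HilbertBasis (IndexSet n) ℂ K)
include hα

/-- The functional on `B(K)` determined by a map on `B(H)` and a vector `ξ`. -/
noncomputable def functional (ξ : H) (L : (H →L[ℂ] H) →L[ℂ] (H →L[ℂ] H)) :
    (K →L[ℂ] K) →L[ℂ] ℂ :=
  vectorFunctional ξ ξ ∘L L ∘L
    sandwich (hα.family.columnMap e ξ) (hα.family.columnMap e ξ).adjoint

theorem functional_apply (ξ : H) (L : (H →L[ℂ] H) →L[ℂ] (H →L[ℂ] H)) (b : K →L[ℂ] K) :
    hα.functional e ξ L b = inner ℂ ξ (L (hα.family.columnMap e ξ ∘L b ∘L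
      (hα.family.columnMap e ξ).adjoint) ξ) := rfl

theorem isPositiveMap_functional (ξ : H) {L : (H →L[ℂ] H) →L[ℂ] (H →L[ℂ] H)}
    (hL : IsPositiveMap L) : IsPositiveMap (hα.functional e ξ L) :=
  (isPositiveMap_vectorFunctional ξ).comp (hL.comp (isPositiveMap_sandwich _))

/-- L(1 ⊗ b) commutes with every c, because L is a bimodule map over α and 1 ⊗ b commutes with α(c).
It is therefore a scalar, read off at ξ. -/
theorem map_mul_commutant_eq {ξ : H} (hξ : ‖ξ‖ = 1) {L : (H →L[ℂ] H) →L[ℂ] (H →L[ℂ] H)}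
    (hL : IsTransferOperator α L) (c : H →L[ℂ] H) (b : K →L[ℂ] K) :
    L (α c * hα.commutant e b) = hα.functional e ξ L b • c := by
  have h1 : ∀ c, c * L (hα.commutant e b) = L (hα.commutant e b) * c := fun c => by
    rw [← hL.transfer, ← hL.transfer_right, hα.commutant_mul_map]
  have h2 : hα.functional e ξ L b = inner ℂ ξ (L (hα.commutant e b) ξ) := by
    rw [functional_apply, ← hα.map_rankOne_mul_commutant, hL.transfer, h1, mul_apply_eq_comp,
      InnerProductSpace.rankOne_apply, inner_self_eq_norm_sq_to_K, hξ]
    simp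
  rw [hL.transfer, eq_smul_one_of_commute h1 hξ, ← h2, mul_smul_comm, mul_one]

theorem isTensorRelated_functional (i₀ : IndexSet n) {ξ : H} (hξ : ‖ξ‖ = 1)
    {L : (H →L[ℂ] H) →L[ℂ] (H →L[ℂ] H)} (hL : IsTransferOperator α L) :
    IsTensorRelated U i₀ e L (hα.functional e ξ L) :=
  (hα.isTensorRelated_iff e i₀ L _).mpr (hα.map_mul_commutant_eq e hξ hL)

/-- The compression of an operator on `H` to an operator on `K` by a pair of columns. -/
noncomputable def compression (ξ η : H) : (H →L[ℂ] H) →L[ℂ] (K →L[ℂ] K) :=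
  sandwich (hα.family.columnMap e ξ).adjoint (hα.family.columnMap e η)

theorem compression_apply (ξ η : H) (x : H →L[ℂ] H) :
    hα.compression e ξ η x =
      (hα.family.columnMap e ξ).adjoint ∘L x ∘L hα.family.columnMap e η := rfl

theorem norm_functional_compression_le (ω : (K →L[ℂ] K) →L[ℂ] ℂ) (ξ η : H) (x : H →L[ℂ] H) :
    ‖ω (hα.compression e ξ η x)‖ ≤ ‖ω‖ * ‖x‖ * ‖ξ‖ * ‖η‖ := by
  calc ‖ω (hα.compression e ξ η x)‖ ≤ ‖ω‖ * ‖hα.compression e ξ η x‖ := ω.le_opNorm _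
    _ ≤ ‖ω‖ * (‖ξ‖ * ‖x‖ * ‖η‖) := by
        gcongr
        refine (norm_sandwich_le _ _ _).trans ?_
        rw [LinearIsometryEquiv.norm_map]
        gcongr
        · exact hα.family.norm_columnMap_le e ξ
        · exact hα.family.norm_columnMap_le e η
    _ = _ := by ring

/-- The right-hand side is a bounded sesquilinear form in (ξ, η), hence is represented by an
operator. -/
theorem exists_slice (ω : (K →L[ℂ] K) →L[ℂ] ℂ) (x : H →L[ℂ] H) :
    ∃ T : H →L[ℂ] H, ∀ ξ η, inner ℂ ξ (T η) = ω (hα.compression e ξ η x) := by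
  let B : H →L⋆[ℂ] H →L[ℂ] ℂ := LinearMap.mkContinuous₂
    (LinearMap.mk₂'ₛₗ (starRingEnd ℂ) (RingHom.id ℂ) (fun ξ η => ω (hα.compression e ξ η x))
      (fun ξ ξ' η => by simp [compression_apply])
      (fun c ξ η => by simp [compression_apply, map_smulₛₗ])
      (fun ξ η η' => by simp [compression_apply])
      (fun c ξ η => by simp [compression_apply]))
    (‖ω‖ * ‖x‖) (fun ξ η => hα.norm_functional_compression_le e ω ξ η x)
  refine ⟨(InnerProductSpace.continuousLinearMapOfBilin B).adjoint, fun ξ η => ?_⟩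
  rw [ContinuousLinearMap.adjoint_inner_right,
    InnerProductSpace.continuousLinearMapOfBilin_apply]
  rfl

theorem exists_ofFunctional (ω : (K →L[ℂ] K) →L[ℂ] ℂ) :
    ∃ L : (H →L[ℂ] H) →L[ℂ] (H →L[ℂ] H), ‖L‖ ≤ ‖ω‖ ∧
      ∀ x ξ η, inner ℂ ξ (L x η) = ω (hα.compression e ξ η x) := by
  choose T hT using hα.exists_slice e ω
  let L : (H →L[ℂ] H) →ₗ[ℂ] (H →L[ℂ] H) :=
    { toFun := T
      map_add' := fun x y => by
        ext η
        refine ext_inner_left ℂ fun ξ => ?_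
        rw [add_apply, inner_add_right]
        simp only [hT, map_add]
      map_smul' := fun c x => by
        ext η
        refine ext_inner_left ℂ fun ξ => ?_
        rw [smul_apply, inner_smul_right]
        simp only [hT, map_smul, smul_eq_mul, RingHom.id_apply] }
  have hb : ∀ x, ‖L x‖ ≤ ‖ω‖ * ‖x‖ := fun x => by
    refine ContinuousLinearMap.opNorm_le_of_re_inner_le (by positivity) fun η ξ hη hξ => ?_
    rw [inner_re_symm]
    refine (Complex.re_le_norm _).trans ?_
    change ‖inner ℂ ξ (T x η)‖ ≤ _
    rw [hT]
    refine (hα.norm_functional_compression_le e ω ξ η x).trans_eq ?_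
    rw [hξ, hη, mul_one, mul_one]
  exact ⟨L.mkContinuous ‖ω‖ hb, L.mkContinuous_norm_le (norm_nonneg _) hb, hT⟩

/-- The slice map `ω ⊗ id`, determined by `⟨ξ, L x η⟩ = ω (J_ξ* x J_η)` with columns `J_ξ`. -/
noncomputable def ofFunctional (ω : (K →L[ℂ] K) →L[ℂ] ℂ) :
    (H →L[ℂ] H) →L[ℂ] (H →L[ℂ] H) :=
  (hα.exists_ofFunctional e ω).choose

theorem norm_ofFunctional_le (ω : (K →L[ℂ] K) →L[ℂ] ℂ) : ‖hα.ofFunctional e ω‖ ≤ ‖ω‖ :=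
  (hα.exists_ofFunctional e ω).choose_spec.1

theorem inner_ofFunctional (ω : (K →L[ℂ] K) →L[ℂ] ℂ) (x : H →L[ℂ] H) (ξ η : H) :
    inner ℂ ξ (hα.ofFunctional e ω x η) = ω (hα.compression e ξ η x) :=
  (hα.exists_ofFunctional e ω).choose_spec.2 x ξ η

theorem ofFunctional_eq {ω : (K →L[ℂ] K) →L[ℂ] ℂ} {L : (H →L[ℂ] H) →L[ℂ] (H →L[ℂ] H)}
    (h : ∀ x ξ η, inner ℂ ξ (L x η) = ω (hα.compression e ξ η x)) :
    hα.ofFunctional e ω = L := by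
  ext x η
  exact ext_inner_left ℂ fun ξ => by rw [inner_ofFunctional, h]

theorem ofFunctional_sub (ω ω' : (K →L[ℂ] K) →L[ℂ] ℂ) :
    hα.ofFunctional e (ω - ω') = hα.ofFunctional e ω - hα.ofFunctional e ω' :=
  hα.ofFunctional_eq e fun x ξ η => by
    simp only [sub_apply, inner_sub_right, inner_ofFunctional]

theorem isTransferOperator_ofFunctional {ω : (K →L[ℂ] K) →L[ℂ] ℂ} (hω : IsPositiveMap ω) :
    IsTransferOperator α (hα.ofFunctional e ω) where
  positive x hx := nonneg_iff_inner.mpr fun ξ => by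
    rw [inner_ofFunctional]
    exact hω _ (isPositiveMap_sandwich_adjoint _ x hx)
  transfer a x := by
    ext η
    refine ext_inner_left ℂ fun ξ => ?_
    rw [mul_apply_eq_comp, ← ContinuousLinearMap.adjoint_inner_left a, inner_ofFunctional,
      inner_ofFunctional]
    -- J_ξ* α(a) = J_{a*ξ}*, so α(a) can be moved into the left column.
    congr 1
    ext ζ
    refine ext_inner_left ℂ fun θ => ?_
    rw [compression_apply, compression_apply]
    simp only [ContinuousLinearMap.comp_apply, ContinuousLinearMap.adjoint_inner_right]
    rw [← hα.map_columnMap, ← ContinuousLinearMap.star_eq_adjoint, map_star,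
      ContinuousLinearMap.star_eq_adjoint, ContinuousLinearMap.adjoint_inner_left]
    rfl

theorem ofFunctional_map_mul_commutant (ω : (K →L[ℂ] K) →L[ℂ] ℂ) (c : H →L[ℂ] H)
    (b : K →L[ℂ] K) : hα.ofFunctional e ω (α c * hα.commutant e b) = ω b • c := by
  ext η
  refine ext_inner_left ℂ fun ξ => ?_
  have h : hα.compression e ξ η (α c * hα.commutant e b) = inner ℂ ξ (c η) • b := by
    ext ζ
    change (hα.family.columnMap e ξ).adjoint
      (α c (hα.commutant e b (hα.family.columnMap e η ζ))) = _
    rw [hα.commutant_columnMap, hα.map_columnMap, hα.family.adjoint_columnMap_columnMap]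
    rfl
  rw [inner_ofFunctional, h, map_smul, smul_apply, inner_smul_right,
    smul_eq_mul, mul_comm]

theorem functional_ofFunctional {ξ : H} (hξ : ‖ξ‖ = 1) (ω : (K →L[ℂ] K) →L[ℂ] ℂ) :
    hα.functional e ξ (hα.ofFunctional e ω) = ω := by
  ext b
  rw [functional_apply, ← hα.map_rankOne_mul_commutant, ofFunctional_map_mul_commutant,
    smul_apply, InnerProductSpace.rankOne_apply, inner_smul_right,
    inner_smul_right, inner_self_eq_norm_sq_to_K, hξ]
  simp

theorem norm_functional_le {ξ : H} (hξ : ‖ξ‖ = 1) (L : (H →L[ℂ] H) →L[ℂ] (H →L[ℂ] H)) :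
    ‖hα.functional e ξ L‖ ≤ ‖L‖ := by
  refine ContinuousLinearMap.opNorm_le_bound _ (norm_nonneg _) fun b => ?_
  have h1 : ‖sandwich (hα.family.columnMap e ξ) (hα.family.columnMap e ξ).adjoint b‖ ≤ ‖b‖ := by
    refine (norm_sandwich_le _ _ _).trans ?_
    rw [LinearIsometryEquiv.norm_map]
    have h := hα.family.norm_columnMap_le e ξ
    rw [hξ] at h
    calc _ ≤ 1 * ‖b‖ * 1 := by gcongr
      _ = ‖b‖ := by ring
  rw [functional_apply]
  refine (norm_inner_le_norm _ _).trans ?_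
  rw [hξ, one_mul]
  refine (ContinuousLinearMap.le_opNorm _ _).trans ?_
  rw [hξ, mul_one]
  exact (L.le_opNorm _).trans (mul_le_mul_of_nonneg_left h1 (norm_nonneg _))

/-- Slicing and its left inverse `functional` are both contractive. Positivity of ω is not required,
so the equality also applies to differences of functionals. -/
theorem norm_ofFunctional [Nontrivial H] (ω : (K →L[ℂ] K) →L[ℂ] ℂ) :
    ‖hα.ofFunctional e ω‖ = ‖ω‖ := by
  obtain ⟨ξ, hξ⟩ := exists_norm_eq H zero_le_one
  refine le_antisymm (hα.norm_ofFunctional_le e ω) ?_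
  conv_lhs => rw [← hα.functional_ofFunctional e hξ ω]
  exact hα.norm_functional_le e hξ _

end IsImplementedBy

end Correspondence

/-! ### Suprema of monotone nets as weak limits. -/

section MonotoneNets

set_option linter.unusedSectionVars false

variable {ι H : Type*} [Preorder ι] [IsDirectedOrder ι] [Nonempty ι]
  [NormedAddCommGroup H] [InnerProductSpace ℂ H] [CompleteSpace H]

theorem isLUB_range_of_tendsto_inner {d : ι → (H →L[ℂ] H)} (hd : Monotone d) {s : H →L[ℂ] H}
    (h : ∀ x, Tendsto (fun i => inner ℂ x (d i x)) atTop (𝓝 (inner ℂ x (s x)))) :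
    IsLUB (Set.range d) s := by
  constructor
  · rintro _ ⟨i, rfl⟩
    rw [← sub_nonneg, nonneg_iff_inner]
    intro x
    rw [sub_apply, inner_sub_right, sub_nonneg]
    refine ge_of_tendsto (h x) ((eventually_ge_atTop i).mono fun j hj => ?_)
    have h1 := nonneg_iff_inner.mp (sub_nonneg.mpr (hd hj)) x
    rwa [sub_apply, inner_sub_right, sub_nonneg] at h1
  · intro u hu
    rw [← sub_nonneg, nonneg_iff_inner]
    intro x
    rw [sub_apply, inner_sub_right, sub_nonneg]
    refine le_of_tendsto (h x) (.of_forall fun j => ?_)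
    have h1 := nonneg_iff_inner.mp (sub_nonneg.mpr (hu ⟨j, rfl⟩)) x
    rwa [sub_apply, inner_sub_right, sub_nonneg] at h1

/-- In the order of ℂ, comparable numbers have equal imaginary parts, so only the real parts move.
-/
theorem exists_tendsto_of_monotone_complex {c : ι → ℂ} (hc : Monotone c) {u : ℂ}
    (hu : ∀ i, c i ≤ u) : ∃ z, Tendsto c atTop (𝓝 z) := by
  have h1 : Monotone fun i => (c i).re := fun i j hij => (Complex.le_def.mp (hc hij)).1
  have h2 : BddAbove (Set.range fun i => (c i).re) :=
    ⟨u.re, by rintro _ ⟨i, rfl⟩; exact (Complex.le_def.mp (hu i)).1⟩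
  have h3 := tendsto_atTop_ciSup h1 h2
  have h4 : c = fun i => (((c i).re : ℝ) : ℂ) + (u.im : ℂ) * Complex.I := by
    ext i
    rw [← (Complex.le_def.mp (hu i)).2, Complex.re_add_im]
  rw [h4]
  exact ⟨_, ((Complex.continuous_ofReal.tendsto _).comp h3).add_const _⟩

theorem tendsto_of_isLUB_complex {c : ι → ℂ} (hc : Monotone c) {z : ℂ}
    (hz : IsLUB (Set.range c) z) : Tendsto c atTop (𝓝 z) := by
  obtain ⟨w, hw⟩ := exists_tendsto_of_monotone_complex hc fun i => hz.1 ⟨i, rfl⟩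
  have h1 : IsLUB (Set.range c) w := by
    constructor
    · rintro _ ⟨i, rfl⟩
      exact ge_of_tendsto hw ((eventually_ge_atTop i).mono fun j hj => hc hj)
    · intro u hu
      exact le_of_tendsto hw (.of_forall fun j => hu ⟨j, rfl⟩)
  rwa [hz.unique h1]

/-- A bounded monotone net of operators converges weakly to its supremum. -/
theorem tendsto_inner_of_isLUB {d : ι → (H →L[ℂ] H)} (hd : Monotone d) {s : H →L[ℂ] H}
    (hs : IsLUB (Set.range d) s) (x y : H) :
    Tendsto (fun i => inner ℂ x (d i y)) atTop (𝓝 (inner ℂ x (s y))) := by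
  have hmono : ∀ x : H, Monotone fun i => inner ℂ x (d i x) := fun x i j hij =>
    (isPositiveMap_vectorFunctional x).monotone (hd hij)
  have hle : ∀ (x : H) i, inner ℂ x (d i x) ≤ inner ℂ x (s x) := fun x i =>
    (isPositiveMap_vectorFunctional x).monotone (hs.1 ⟨i, rfl⟩)
  have hex : ∀ x y : H, ∃ z, Tendsto (fun i => inner ℂ x (d i y)) atTop (𝓝 z) := by
    intro x y
    have hq : ∀ v : H, ∃ z, Tendsto (fun i => inner ℂ v (d i v)) atTop (𝓝 z) := fun v =>
      exists_tendsto_of_monotone_complex (hmono v) (hle v)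
    obtain ⟨z1, h1⟩ := hq (x + y)
    obtain ⟨z2, h2⟩ := hq (x - y)
    obtain ⟨z3, h3⟩ := hq (x + Complex.I • y)
    obtain ⟨z4, h4⟩ := hq (x - Complex.I • y)
    -- Polarization reduces the matrix coefficients to the monotone quadratic forms.
    refine ⟨_, ((((h1.sub h2).sub (h3.const_mul Complex.I)).add
      (h4.const_mul Complex.I)).div_const 4).congr fun i => ?_⟩
    simp only [map_add, map_sub, map_smul, inner_add_left, inner_add_right, inner_sub_left,
      inner_sub_right, inner_smul_left, inner_smul_right, Complex.conj_I]
    linear_combination (-(inner ℂ x (d i y)) / 2 + inner ℂ y (d i x) / 2) * Complex.I_sq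
  choose g hg using hex
  obtain ⟨i₀⟩ := ‹Nonempty ι›
  -- The net need only be bounded beyond `i₀`, where 0 ≤ d i − d i₀ ≤ s − d i₀.
  set C := ‖s - d i₀‖ + ‖d i₀‖ with hCdef
  have hC : ∀ i, i₀ ≤ i → ‖d i‖ ≤ C := by
    intro i hi
    have h1 : ‖d i - d i₀‖ ≤ ‖s - d i₀‖ :=
      CStarAlgebra.norm_le_norm_of_nonneg_of_le (sub_nonneg.mpr (hd hi))
        (sub_le_sub_right (hs.1 ⟨i, rfl⟩) _)
    calc ‖d i‖ = ‖(d i - d i₀) + d i₀‖ := by rw [sub_add_cancel]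
      _ ≤ ‖d i - d i₀‖ + ‖d i₀‖ := norm_add_le _ _
      _ ≤ C := add_le_add_left h1 _
  let B : H →L⋆[ℂ] H →L[ℂ] ℂ := LinearMap.mkContinuous₂
    (LinearMap.mk₂'ₛₗ (starRingEnd ℂ) (RingHom.id ℂ) g
      (fun x x' y => tendsto_nhds_unique (hg _ _) (by
        simpa only [inner_add_left] using (hg x y).add (hg x' y)))
      (fun c x y => tendsto_nhds_unique (hg _ _) (by
        simpa only [inner_smul_left, smul_eq_mul] using (hg x y).const_mul (starRingEnd ℂ c)))
      (fun x y y' => tendsto_nhds_unique (hg _ _) (by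
        simpa only [map_add, inner_add_right] using (hg x y).add (hg x y')))
      (fun c x y => tendsto_nhds_unique (hg _ _) (by
        simpa only [map_smul, inner_smul_right, smul_eq_mul, RingHom.id_apply] using (hg x y).const_mul c)))
    C (fun x y => by
      refine le_of_tendsto (hg x y).norm ((eventually_ge_atTop i₀).mono fun i hi => ?_)
      calc ‖inner ℂ x (d i y)‖ ≤ ‖x‖ * (‖d i‖ * ‖y‖) :=
            (norm_inner_le_norm _ _).trans (by gcongr; exact (d i).le_opNorm y)
        _ ≤ ‖x‖ * (C * ‖y‖) := by gcongr; exact hC i hi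
        _ = C * ‖x‖ * ‖y‖ := by ring)
  set T := (InnerProductSpace.continuousLinearMapOfBilin B).adjoint
  have hT : ∀ x y, Tendsto (fun i => inner ℂ x (d i y)) atTop (𝓝 (inner ℂ x (T y))) := by
    intro x y
    rw [ContinuousLinearMap.adjoint_inner_right,
      InnerProductSpace.continuousLinearMapOfBilin_apply]
    exact hg x y
  -- The weak limit is itself a least upper bound, so it is s.
  have hsT : s = T := hs.unique (isLUB_range_of_tendsto_inner hd fun x => hT x x)
  rw [hsT]
  exact hT x y

end MonotoneNets

/-! ### Normality of compressions, vector functionals and compositions. -/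

section NormalMaps

set_option linter.unusedSectionVars false

variable {A B C H K : Type*} [CStarAlgebra A] [PartialOrder A] [StarOrderedRing A]
  [CStarAlgebra B] [PartialOrder B] [StarOrderedRing B]
  [CStarAlgebra C] [PartialOrder C] [StarOrderedRing C]
  [NormedAddCommGroup H] [InnerProductSpace ℂ H] [CompleteSpace H]
  [NormedAddCommGroup K] [InnerProductSpace ℂ K] [CompleteSpace K]

theorem IsNormalMap.comp {S : B →L[ℂ] C} {T : A →L[ℂ] B} (hS : IsNormalMap S)
    (hT : IsNormalMap T) (pT : IsPositiveMap T) : IsNormalMap (S ∘L T) := by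
  intro D hD dD sD s hs
  have h := hS (T '' D) (hD.image T) ?_ ?_ (T s) (hT D hD dD sD s hs)
  · rwa [Set.image_image] at h
  · rintro _ ⟨a, ha, rfl⟩ _ ⟨b, hb, rfl⟩
    obtain ⟨c, hc, hac, hbc⟩ := dD a ha b hb
    exact ⟨T c, ⟨c, hc, rfl⟩, pT.monotone hac, pT.monotone hbc⟩
  · rintro _ ⟨a, ha, rfl⟩
    rw [IsSelfAdjoint, ← pT.map_star, sD a ha]

theorem IsNormalMap.isLUB_range {ι : Type*} [Preorder ι] [IsDirectedOrder ι] [Nonempty ι]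
    {T : A →L[ℂ] B} (hT : IsNormalMap T) {d : ι → A} (hd : Monotone d)
    (hsa : ∀ i, IsSelfAdjoint (d i)) {s : A} (hs : IsLUB (Set.range d) s) :
    IsLUB (Set.range fun i => T (d i)) (T s) := by
  have h := hT (Set.range d) (Set.range_nonempty d) ?_ ?_ s hs
  · rwa [← Set.range_comp] at h
  · rintro _ ⟨i, rfl⟩ _ ⟨j, rfl⟩
    obtain ⟨k, hik, hjk⟩ := exists_ge_ge i j
    exact ⟨d k, ⟨k, rfl⟩, hd hik, hd hjk⟩
  · rintro _ ⟨i, rfl⟩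
    exact hsa i

theorem isNormalMap_of_tendsto_inner {T : A →L[ℂ] (H →L[ℂ] H)} (pT : IsPositiveMap T)
    (h : ∀ D : Set A, D.Nonempty → DirectedOn (· ≤ ·) D → (∀ d ∈ D, IsSelfAdjoint d) →
      ∀ s : A, IsLUB D s →
        ∀ x, Tendsto (fun d : D => inner ℂ x (T d x)) atTop (𝓝 (inner ℂ x (T s x)))) :
    IsNormalMap T := by
  intro D hD dD sD s hs
  have : Nonempty D := hD.to_subtype
  have : IsDirectedOrder D := ⟨dD.directed_val⟩
  rw [Set.image_eq_range]
  exact isLUB_range_of_tendsto_inner (d := fun d : D => T d) (fun a b hab => pT.monotone hab) (h D hD dD sD s hs)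

theorem tendsto_inner_of_directedOn {D : Set (H →L[ℂ] H)} {s : H →L[ℂ] H} (hD : D.Nonempty)
    (dD : DirectedOn (· ≤ ·) D) (hs : IsLUB D s) (x y : H) :
    Tendsto (fun d : D => inner ℂ x (d.1 y)) atTop (𝓝 (inner ℂ x (s y))) := by
  have : Nonempty D := hD.to_subtype
  have : IsDirectedOrder D := ⟨dD.directed_val⟩
  exact tendsto_inner_of_isLUB (d := ((↑) : D → (H →L[ℂ] H))) (fun a b hab => hab)
    (by rwa [Subtype.range_coe]) x y

theorem isNormalMap_sandwich (S : K →L[ℂ] H) : IsNormalMap (sandwich S S.adjoint) := by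
  refine isNormalMap_of_tendsto_inner (isPositiveMap_sandwich S) fun D hD dD sD s hs x => ?_
  have key : ∀ T : K →L[ℂ] K, inner ℂ x (sandwich S S.adjoint T x) =
      inner ℂ (S.adjoint x) (T (S.adjoint x)) := fun T => by
    rw [ContinuousLinearMap.adjoint_inner_left, sandwich_apply, ContinuousLinearMap.comp_apply,
      ContinuousLinearMap.comp_apply]
  simp only [key]
  exact tendsto_inner_of_directedOn hD dD hs (S.adjoint x) (S.adjoint x)

theorem isNormalMap_sandwich_adjoint (S : K →L[ℂ] H) : IsNormalMap (sandwich S.adjoint S) := by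
  have h := isNormalMap_sandwich S.adjoint
  rwa [ContinuousLinearMap.adjoint_adjoint] at h

theorem isNormalMap_vectorFunctional (x : H) : IsNormalMap (vectorFunctional x x) := by
  intro D hD dD sD s hs
  have h := tendsto_inner_of_directedOn hD dD hs x x
  have : Nonempty D := hD.to_subtype
  have : IsDirectedOrder D := ⟨dD.directed_val⟩
  refine ⟨?_, fun u hu => le_of_tendsto h (.of_forall fun d => hu ⟨d, d.2, rfl⟩)⟩
  rintro _ ⟨d, hd, rfl⟩
  exact (isPositiveMap_vectorFunctional x).monotone (hs.1 hd)

theorem IsNormalMap.tendsto {φ : A →L[ℂ] ℂ} (hφ : IsNormalMap φ) (pφ : IsPositiveMap φ)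
    {ι : Type*} [Preorder ι] [IsDirectedOrder ι] [Nonempty ι] {d : ι → A} (hd : Monotone d)
    (hsa : ∀ i, IsSelfAdjoint (d i)) {s : A} (hs : IsLUB (Set.range d) s) :
    Tendsto (fun i => φ (d i)) atTop (𝓝 (φ s)) :=
  tendsto_of_isLUB_complex (pφ.monotone.comp hd) (hφ.isLUB_range hd hsa hs)

theorem isNormalMap_of_vectorFunctional {T : A →L[ℂ] (H →L[ℂ] H)} (pT : IsPositiveMap T)
    (h : ∀ x, IsNormalMap (vectorFunctional x x ∘L T)) : IsNormalMap T := by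
  refine isNormalMap_of_tendsto_inner pT fun D hD dD sD s hs x => ?_
  have : Nonempty D := hD.to_subtype
  have : IsDirectedOrder D := ⟨dD.directed_val⟩
  exact (h x).tendsto ((isPositiveMap_vectorFunctional x).comp pT) (d := ((↑) : D → A))
    (fun a b hab => hab) (fun d => sD d d.2) (by rwa [Subtype.range_coe])

end NormalMaps

/-! ### Normal transfer operators, the cone isomorphism, singularity. -/

section Correspondence

set_option linter.unusedSectionVars false

variable {H K : Type*} [NormedAddCommGroup H] [InnerProductSpace ℂ H] [CompleteSpace H]
  [NormedAddCommGroup K] [InnerProductSpace ℂ K] [CompleteSpace K]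

theorem eq_of_inner_self_eq {S T : H →L[ℂ] H} (h : ∀ ξ, inner ℂ ξ (S ξ) = inner ℂ ξ (T ξ)) :
    S = T := by
  refine le_antisymm ?_ ?_ <;> rw [← sub_nonneg, nonneg_iff_inner] <;> intro ξ <;>
    rw [sub_apply, inner_sub_right, h, sub_self]

namespace IsImplementedBy

variable {n : ℕ∞} {α : (H →L[ℂ] H) →⋆ₙₐ[ℂ] (H →L[ℂ] H)} {U : IndexSet n → (H →L[ℂ] H)}
  (hα : IsImplementedBy α U)
include hα

theorem star_mul_self (i : IndexSet n) : star (U i) * U i = 1 := by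
  ext x
  exact hα.family.adjoint_apply_self i x

theorem star_mul_of_ne {i j : IndexSet n} (hij : i ≠ j) : star (U i) * U j = 0 := by
  ext x
  exact hα.family.adjoint_apply_of_ne hij x

theorem map_mul_isometry (a : H →L[ℂ] H) (i : IndexSet n) : α a * U i = U i * a := by
  ext x
  exact hα.map_apply_isometry a i x

theorem star_mul_map (a : H →L[ℂ] H) (i : IndexSet n) : star (U i) * α a = a * star (U i) := by
  ext x
  exact hα.adjoint_map_apply a i x

theorem partialSum_mul_self (F : Finset (IndexSet n)) :
    (∑ i ∈ F, U i * star (U i)) * (∑ i ∈ F, U i * star (U i)) = ∑ i ∈ F, U i * star (U i) := by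
  classical
  rw [Finset.sum_mul]
  refine Finset.sum_congr rfl fun i hi => ?_
  rw [Finset.mul_sum, Finset.sum_eq_single i]
  · rw [mul_assoc, ← mul_assoc (star (U i)), hα.star_mul_self, one_mul]
  · intro j _ hj
    rw [mul_assoc, ← mul_assoc (star (U i)), hα.star_mul_of_ne hj.symm, zero_mul, mul_zero]
  · exact fun h => absurd hi h

theorem map_one_mul_partialSum (F : Finset (IndexSet n)) :
    α 1 * (∑ i ∈ F, U i * star (U i)) = ∑ i ∈ F, U i * star (U i) := by
  rw [Finset.mul_sum]
  exact Finset.sum_congr rfl fun i _ => by rw [← mul_assoc, hα.map_mul_isometry, mul_one]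

theorem partialSum_mul_map_one (F : Finset (IndexSet n)) :
    (∑ i ∈ F, U i * star (U i)) * α 1 = ∑ i ∈ F, U i * star (U i) := by
  rw [Finset.sum_mul]
  exact Finset.sum_congr rfl fun i _ => by rw [mul_assoc, hα.star_mul_map, one_mul]

omit hα in
theorem star_partialSum (F : Finset (IndexSet n)) :
    star (∑ i ∈ F, U i * star (U i)) = ∑ i ∈ F, U i * star (U i) := by
  rw [star_sum]
  exact Finset.sum_congr rfl fun i _ => by rw [star_mul, star_star]

omit hα in
theorem monotone_partialSum :
    Monotone fun F : Finset (IndexSet n) => ∑ i ∈ F, U i * star (U i) := fun _ _ hFG =>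
  Finset.sum_le_sum_of_subset_of_nonneg hFG fun _ _ _ => mul_star_self_nonneg _

theorem tendsto_partialSum_apply (y : H) :
    Tendsto (fun F : Finset (IndexSet n) => (∑ i ∈ F, U i * star (U i)) y) atTop
      (𝓝 (α 1 y)) := by
  have h : Tendsto (fun F : Finset (IndexSet n) => ∑ i ∈ F, U i ((U i).adjoint y)) atTop
      (𝓝 (α 1 y)) := hα.hasSum_map_one y
  refine h.congr fun F => ?_
  rw [sum_apply]
  rfl

theorem isLUB_partialSum :
    IsLUB (Set.range fun F : Finset (IndexSet n) => ∑ i ∈ F, U i * star (U i)) (α 1) := by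
  classical
  exact isLUB_range_of_tendsto_inner monotone_partialSum fun x =>
    tendsto_const_nhds.inner (hα.tendsto_partialSum_apply x)

/-- For a normal transfer operator, `⟨ξ, L(x) ξ⟩ = ∑ i, ⟨ξ, L(U i (U i)* x) ξ⟩`. -/
theorem hasSum_inner_of_isNormalMap {L : (H →L[ℂ] H) →L[ℂ] (H →L[ℂ] H)}
    (hL : IsTransferOperator α L) (nL : IsNormalMap L) (x : H →L[ℂ] H) (ξ : H) :
    HasSum (fun i => inner ℂ ξ (L (U i * star (U i) * x) ξ)) (inner ℂ ξ (L x ξ)) := by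
  classical
  set φ := vectorFunctional ξ ξ ∘L L with hφ
  have pφ : IsPositiveMap φ := (isPositiveMap_vectorFunctional ξ).comp hL.positive
  have nφ : IsNormalMap φ := (isNormalMap_vectorFunctional ξ).comp nL hL.positive
  have h1 : Tendsto (fun F : Finset (IndexSet n) => φ (∑ i ∈ F, U i * star (U i))) atTop
      (𝓝 (φ (α 1))) :=
    nφ.tendsto pφ monotone_partialSum (fun F => star_partialSum F) hα.isLUB_partialSum
  -- α(1) − d is a projection and φ(α(1)x) = φ(x), so Cauchy–Schwarz bounds the error by φ(α(1) −
  -- d), which tends to 0 by normality.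
  have h2 : ∀ F : Finset (IndexSet n), ‖φ (∑ i ∈ F, U i * star (U i) * x) - φ x‖ ≤
      √(‖φ (α 1) - φ (∑ i ∈ F, U i * star (U i))‖ * ‖φ (star x * x)‖) := by
    intro F
    set d := ∑ i ∈ F, U i * star (U i) with hd
    have hs : star (α 1 - d) = α 1 - d := by
      rw [star_sub, ← map_star, star_one, star_partialSum]
    have hsq : star (α 1 - d) * (α 1 - d) = α 1 - d := by
      rw [hs, sub_mul, mul_sub, mul_sub, ← map_mul, one_mul, hα.map_one_mul_partialSum,
        hα.partialSum_mul_map_one, hα.partialSum_mul_self, sub_self, sub_zero]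
    have h3 := pφ.norm_sq_apply_le (α 1 - d) x
    rw [hsq, hs, sub_mul, map_sub, map_sub] at h3
    refine Real.le_sqrt_of_sq_le ?_
    rw [norm_sub_rev, ← Finset.sum_mul]
    have h4 : φ (α 1 * x) = φ x := congrArg (vectorFunctional ξ ξ) (hL.map_one_mul x)
    rwa [h4] at h3
  have h3 : Tendsto (fun F : Finset (IndexSet n) =>
      √(‖φ (α 1) - φ (∑ i ∈ F, U i * star (U i))‖ * ‖φ (star x * x)‖)) atTop (𝓝 0) := by
    have := (((tendsto_const_nhds (x := φ (α 1))).sub h1).norm.mul_const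
      ‖φ (star x * x)‖).sqrt
    simpa using this
  have h4 := squeeze_zero (fun F => norm_nonneg _) h2 h3
  have h5 := tendsto_iff_norm_sub_tendsto_zero.mpr h4
  change Tendsto (fun F : Finset (IndexSet n) => ∑ i ∈ F, φ (U i * star (U i) * x)) atTop
    (𝓝 (φ x))
  simpa only [map_sum] using h5

theorem eq_of_isNormalMap {L L' : (H →L[ℂ] H) →L[ℂ] (H →L[ℂ] H)}
    (hL : IsTransferOperator α L) (nL : IsNormalMap L) (hL' : IsTransferOperator α L')
    (nL' : IsNormalMap L') (h : ∀ i j c, L (U i * c * star (U j)) = L' (U i * c * star (U j))) :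
    L = L' := by
  -- The expansion inserts projections on the left only; applied again after taking adjoints, it
  -- inserts them on the right as well.
  have step : ∀ x, (∀ i, L (U i * star (U i) * x) = L' (U i * star (U i) * x)) → L x = L' x := by
    refine fun x hx => eq_of_inner_self_eq fun ξ => ?_
    refine (hα.hasSum_inner_of_isNormalMap hL nL x ξ).unique ?_
    simp only [hx]
    exact hα.hasSum_inner_of_isNormalMap hL' nL' x ξ
  ext1 x
  refine step x fun i => ?_
  have h1 : L (star x * (U i * star (U i))) = L' (star x * (U i * star (U i))) := by
    refine step _ fun j => ?_
    have h2 : U j * star (U j) * (star x * (U i * star (U i))) =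
      U j * (star (U j) * star x * U i) * star (U i) := by noncomm_ring
    rw [h2, h]
  have h3 : U i * star (U i) * x = star (star x * (U i * star (U i))) := by
    simp [mul_assoc]
  rw [h3, hL.positive.map_star, hL'.positive.map_star, h1]

theorem norm_partialSum_apply_le (F : Finset (IndexSet n)) (y : H) :
    ‖(∑ i ∈ F, U i * star (U i)) y‖ ≤ ‖y‖ := by
  rw [sum_apply]
  refine le_of_sq_le_sq ?_ (norm_nonneg _)
  exact (hα.family.orthogonalFamily.norm_sum (fun i => (U i).adjoint y) F).trans_le
    (hα.family.sum_norm_sq_adjoint_le y F)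

/-- The partial sums are contractions converging strongly, hence uniformly on the totally bounded
image of the unit ball under x; this is norm convergence. -/
theorem hasSum_mul_of_isCompactOperator {x : H →L[ℂ] H} (hx : IsCompactOperator x) :
    HasSum (fun i => U i * star (U i) * x) (α 1 * x) := by
  change Tendsto (fun F : Finset (IndexSet n) => ∑ i ∈ F, U i * star (U i) * x) atTop
    (𝓝 (α 1 * x))
  simp only [← Finset.sum_mul]
  rw [Metric.tendsto_nhds]
  intro ε hε
  have htb : TotallyBounded (x '' Metric.closedBall 0 1) :=
    (hx.isCompact_closure_image_closedBall 1).totallyBounded.subset subset_closure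
  -- Replacing x v by a point of the net costs ε/8 under each of two contractions, and the net point
  -- costs ε/4: in all ε/2.
  obtain ⟨t, ht, hxt⟩ := Metric.totallyBounded_iff.mp htb (ε / 8) (by positivity)
  have h1 : ∀ᶠ F : Finset (IndexSet n) in atTop, ∀ y ∈ t,
      dist ((∑ i ∈ F, U i * star (U i)) y) (α 1 y) < ε / 4 :=
    (eventually_all_finite ht).mpr fun y _ =>
      Metric.tendsto_nhds.mp (hα.tendsto_partialSum_apply y) _ (by positivity)
  refine h1.mono fun F hF => ?_
  set d := ∑ i ∈ F, U i * star (U i)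
  have hP : ∀ z, ‖α 1 z‖ ≤ ‖z‖ := fun z =>
    le_of_tendsto (hα.tendsto_partialSum_apply z).norm
      (.of_forall fun G => hα.norm_partialSum_apply_le G z)
  rw [dist_eq_norm]
  refine lt_of_le_of_lt (ContinuousLinearMap.opNorm_le_of_unit_norm (C := ε / 2) (by positivity)
    fun v hv => ?_) (half_lt_self hε)
  obtain ⟨y, hy, hvy⟩ := Set.mem_iUnion₂.mp (hxt ⟨v, by simp [hv], rfl⟩)
  rw [Metric.mem_ball, dist_eq_norm] at hvy
  have h2 := hF y hy
  rw [dist_eq_norm] at h2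
  have h3 : (d * x - α 1 * x) v = d (x v - y) - α 1 (x v - y) + (d y - α 1 y) := by
    simp only [map_sub]
    change d (x v) - α 1 (x v) = _
    abel
  rw [h3]
  have h4 := hα.norm_partialSum_apply_le F (x v - y)
  have h5 := hP (x v - y)
  have h6 := norm_add_le (d (x v - y) - α 1 (x v - y)) (d y - α 1 y)
  have h7 := norm_sub_le (d (x v - y)) (α 1 (x v - y))
  linarith

variable (e : HilbertBasis (IndexSet n) ℂ K)

theorem isometry_mul_star_eq (i j : IndexSet n) (c : H →L[ℂ] H) :
    U i * c * star (U j) =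
      α c * hα.commutant e (InnerProductSpace.rankOne ℂ (e i) (e j)) := by
  refine hα.ext_of_mul_map_one ?_ ?_ fun k x => ?_
  · rw [mul_assoc, hα.star_mul_map, one_mul]
  · rw [mul_assoc, hα.commutant_mul_map_one]
  · change U i (c ((U j).adjoint (U k x))) = α c (hα.commutant e _ (U k x))
    rw [← hα.family.columnMap_basis e x k, hα.commutant_columnMap, hα.map_columnMap,
      hα.family.adjoint_columnMap, InnerProductSpace.rankOne_apply, map_smul, map_smul, map_smul,
      hα.family.columnMap_basis]

theorem apply_isometry_mul_star {i₀ : IndexSet n} {L : (H →L[ℂ] H) →L[ℂ] (H →L[ℂ] H)}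
    {ω : (K →L[ℂ] K) →L[ℂ] ℂ} (h : IsTensorRelated U i₀ e L ω) (i j : IndexSet n)
    (c : H →L[ℂ] H) :
    L (U i * c * star (U j)) = ω (InnerProductSpace.rankOne ℂ (e i) (e j)) • c := by
  rw [hα.isometry_mul_star_eq e, (hα.isTensorRelated_iff e i₀ L ω).mp h]

theorem isTensorRelated_ofFunctional (i₀ : IndexSet n) (ω : (K →L[ℂ] K) →L[ℂ] ℂ) :
    IsTensorRelated U i₀ e (hα.ofFunctional e ω) ω :=
  (hα.isTensorRelated_iff e i₀ _ _).mpr (hα.ofFunctional_map_mul_commutant e ω)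

theorem functional_eq_of_isTensorRelated [Nontrivial H] {i₀ : IndexSet n}
    {L : (H →L[ℂ] H) →L[ℂ] (H →L[ℂ] H)} {ω ω' : (K →L[ℂ] K) →L[ℂ] ℂ}
    (h : IsTensorRelated U i₀ e L ω) (h' : IsTensorRelated U i₀ e L ω') : ω = ω' := by
  ext b
  have h1 := (hα.isTensorRelated_iff e i₀ L ω).mp h 1 b
  rw [(hα.isTensorRelated_iff e i₀ L ω').mp h' 1 b] at h1
  exact (smul_left_injective ℂ one_ne_zero h1).symm

theorem isNormalMap_functional (ξ : H) {L : (H →L[ℂ] H) →L[ℂ] (H →L[ℂ] H)}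
    (pL : IsPositiveMap L) (nL : IsNormalMap L) : IsNormalMap (hα.functional e ξ L) :=
  (isNormalMap_vectorFunctional ξ).comp
    (nL.comp (isNormalMap_sandwich _) (isPositiveMap_sandwich _))
    (pL.comp (isPositiveMap_sandwich _))

theorem isNormalMap_ofFunctional {ω : (K →L[ℂ] K) →L[ℂ] ℂ} (pω : IsPositiveMap ω)
    (nω : IsNormalMap ω) : IsNormalMap (hα.ofFunctional e ω) := by
  refine isNormalMap_of_vectorFunctional (hα.isTransferOperator_ofFunctional e pω).positive
    fun ξ => ?_
  have h : vectorFunctional ξ ξ ∘L hα.ofFunctional e ω = ω ∘L hα.compression e ξ ξ := by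
    ext x
    exact hα.inner_ofFunctional e ω x ξ ξ
  rw [h]
  exact nω.comp (isNormalMap_sandwich_adjoint _) (isPositiveMap_sandwich_adjoint _)

theorem ofFunctional_functional {ξ : H} (hξ : ‖ξ‖ = 1) {L : (H →L[ℂ] H) →L[ℂ] (H →L[ℂ] H)}
    (hL : IsTransferOperator α L) (nL : IsNormalMap L) :
    hα.ofFunctional e (hα.functional e ξ L) = L := by
  have pω := hα.isPositiveMap_functional e ξ hL.positive
  refine hα.eq_of_isNormalMap (hα.isTransferOperator_ofFunctional e pω)
    (hα.isNormalMap_ofFunctional e pω (hα.isNormalMap_functional e ξ hL.positive nL))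
    hL nL fun i j c => ?_
  rw [hα.apply_isometry_mul_star e (hα.isTensorRelated_ofFunctional e i _),
    hα.apply_isometry_mul_star e (hα.isTensorRelated_functional e i hξ hL)]

/-- The linear isomorphism between the cones of normal transfer operators and of normal positive
functionals. -/
noncomputable def coneEquiv {ξ : H} (hξ : ‖ξ‖ = 1) :
    normalTransferCone α ≃ₗ[{c : ℝ // 0 ≤ c}] normalFunctionalCone (K →L[ℂ] K) where
  toFun L := ⟨hα.functional e ξ L.1, hα.isPositiveMap_functional e ξ L.2.1.positive,
    hα.isNormalMap_functional e ξ L.2.1.positive L.2.2⟩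
  invFun ω := ⟨hα.ofFunctional e ω.1, hα.isTransferOperator_ofFunctional e ω.2.1,
    hα.isNormalMap_ofFunctional e ω.2.1 ω.2.2⟩
  map_add' L L' := by
    ext b
    simp [functional_apply]
  map_smul' c L := by
    ext b
    exact inner_smul_right_eq_smul ξ _ (c : ℝ)
  left_inv L := Subtype.ext (hα.ofFunctional_functional e hξ L.2.1 L.2.2)
  right_inv ω := Subtype.ext (hα.functional_ofFunctional e hξ ω.1)

theorem norm_functional [Nontrivial H] {ξ : H} (hξ : ‖ξ‖ = 1)
    {L : (H →L[ℂ] H) →L[ℂ] (H →L[ℂ] H)} (hL : IsTransferOperator α L) (nL : IsNormalMap L) :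
    ‖hα.functional e ξ L‖ = ‖L‖ := by
  rw [← hα.norm_ofFunctional e, hα.ofFunctional_functional e hξ hL nL]

theorem exists_coneEquiv [Nontrivial H] (i₀ : IndexSet n) :
    ∃ Φ : normalTransferCone α ≃ₗ[{c : ℝ // 0 ≤ c}] normalFunctionalCone (K →L[ℂ] K),
      (∀ (L : normalTransferCone α) (ω : normalFunctionalCone (K →L[ℂ] K)),
        IsTensorRelated U i₀ e L.1 ω.1 ↔ Φ L = ω) ∧
      (∀ L : normalTransferCone α, ‖(Φ L).1‖ = ‖L.1‖) ∧ Isometry Φ := by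
  obtain ⟨ξ, hξ⟩ := exists_norm_eq H zero_le_one
  refine ⟨hα.coneEquiv e hξ, fun L ω => ⟨fun h => ?_, ?_⟩, fun L => ?_, ?_⟩
  · exact Subtype.ext (hα.functional_eq_of_isTensorRelated e
      (hα.isTensorRelated_functional e i₀ hξ L.2.1) h)
  · rintro rfl
    exact hα.isTensorRelated_functional e i₀ hξ L.2.1
  · exact hα.norm_functional e hξ L.2.1 L.2.2
  · refine Isometry.of_dist_eq fun L L' => ?_
    -- A difference of two positive functionals need not be positive; the norm equality for
    -- arbitrary functionals covers it.
    rw [Subtype.dist_eq, Subtype.dist_eq, dist_eq_norm, dist_eq_norm, ← hα.norm_ofFunctional e,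
      ofFunctional_sub]
    change ‖hα.ofFunctional e (hα.functional e ξ L.1) -
      hα.ofFunctional e (hα.functional e ξ L'.1)‖ = _
    rw [hα.ofFunctional_functional e hξ L.2.1 L.2.2, hα.ofFunctional_functional e hξ L'.2.1 L'.2.2]

omit hα in
theorem _root_.isCompactOperator_rankOne (x y : K) :
    IsCompactOperator (InnerProductSpace.rankOne ℂ x y : K →L[ℂ] K) :=
  (isCompactOperator_of_locallyCompactSpace_rng
    (ContinuousLinearMap.toSpanSingleton ℂ x)).comp_clm (innerSL ℂ y)

/-- If b is compact, so is |ξ⟩⟨ξ| ⊗ b = J_ξ b J_ξ*. Conversely, if ω kills each e_ii, then L kills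
U_i U_i*, by Cauchy–Schwarz also U_i U_i* x, and for compact x the norm-convergent sum of these. -/
theorem isSingularMap_iff [Nontrivial H] {i₀ : IndexSet n} {L : (H →L[ℂ] H) →L[ℂ] (H →L[ℂ] H)}
    {ω : (K →L[ℂ] K) →L[ℂ] ℂ} (hL : IsTransferOperator α L) (h : IsTensorRelated U i₀ e L ω) :
    IsSingularMap L ↔ IsSingularMap ω := by
  constructor
  · intro sL b hb
    obtain ⟨ξ, hξ⟩ := exists_norm_eq H zero_le_one
    have h1 := (hα.isTensorRelated_iff e i₀ L ω).mp h (InnerProductSpace.rankOne ℂ ξ ξ) b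
    rw [hα.map_rankOne_mul_commutant, sL _ ((hb.comp_clm (hα.family.columnMap e ξ).adjoint).clm_comp
      (hα.family.columnMap e ξ))] at h1
    have hξ0 : ξ ≠ 0 := by
      rintro rfl
      simp at hξ
    exact (smul_eq_zero.mp h1.symm).resolve_right (InnerProductSpace.rankOne_ne_zero hξ0 hξ0)
  · intro sω x hx
    have h1 : ∀ i, L (U i * star (U i)) = 0 := fun i => by
      have := hα.apply_isometry_mul_star e h i i 1
      rwa [mul_one, sω _ (isCompactOperator_rankOne _ _), zero_smul] at this
    have h2 : ∀ i, L (U i * star (U i) * x) = 0 := fun i => by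
      refine eq_of_inner_self_eq fun ξ => ?_
      have pφ : IsPositiveMap (vectorFunctional ξ ξ ∘L L) :=
        (isPositiveMap_vectorFunctional ξ).comp hL.positive
      have h3 := pφ.norm_sq_apply_le (U i * star (U i)) x
      have h4 : star (U i * star (U i)) = U i * star (U i) := by rw [star_mul, star_star]
      have h5 : U i * star (U i) * (U i * star (U i)) = U i * star (U i) := by
        rw [mul_assoc, ← mul_assoc (star (U i)), hα.star_mul_self, one_mul]
      rw [h4, h5, ContinuousLinearMap.comp_apply, ContinuousLinearMap.comp_apply, h1, map_zero,
        norm_zero, zero_mul] at h3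
      have h6 := norm_eq_zero.mp (pow_eq_zero_iff two_ne_zero |>.mp (h3.antisymm (by positivity)))
      rw [zero_apply, inner_zero_right]
      exact h6
    have h3 := L.hasSum (hα.hasSum_mul_of_isCompactOperator hx)
    simp only [h2] at h3
    rw [← hL.map_one_mul]
    exact h3.unique hasSum_zero

theorem isNormalMap_of_ne_top (hn : n ≠ ⊤) {i₀ : IndexSet n}
    {L : (H →L[ℂ] H) →L[ℂ] (H →L[ℂ] H)} {ω : (K →L[ℂ] K) →L[ℂ] ℂ}
    (hL : IsTransferOperator α L) (h : IsTensorRelated U i₀ e L ω) : IsNormalMap L := by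
  have hfin : Finite (IndexSet n) := by
    lift n to ℕ using hn
    exact Finite.of_injective (fun i : IndexSet n => (⟨i.1, Nat.cast_lt.mp i.2⟩ : Fin n))
      fun i j hij => Subtype.ext (Fin.mk.inj hij)
  have := Fintype.ofFinite (IndexSet n)
  have h1 : α 1 = ∑ i, U i * star (U i) := by
    ext y
    refine (hα.hasSum_map_one y).unique ?_
    rw [sum_apply]
    exact hasSum_fintype _
  -- Inserting the finite sum α(1) on both sides of x writes L by finitely many weakly continuous
  -- terms.
  have h2 : ∀ x, L x = ∑ i, ∑ j, ω (InnerProductSpace.rankOne ℂ (e i) (e j)) •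
      (star (U i) * x * U j) := by
    intro x
    rw [← hL.map_one_mul, ← hL.mul_map_one, h1, Finset.sum_mul, Finset.sum_mul, map_sum]
    refine Finset.sum_congr rfl fun i _ => ?_
    rw [Finset.mul_sum, map_sum]
    refine Finset.sum_congr rfl fun j _ => ?_
    rw [← hα.apply_isometry_mul_star e h]
    congr 1
  refine isNormalMap_of_tendsto_inner hL.positive fun D hD dD sD s hs ξ => ?_
  have h3 : ∀ x, inner ℂ ξ (L x ξ) = ∑ i, ∑ j, ω (InnerProductSpace.rankOne ℂ (e i) (e j)) *
      inner ℂ (U i ξ) (x (U j ξ)) := by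
    intro x
    rw [h2, sum_apply, inner_sum]
    refine Finset.sum_congr rfl fun i _ => ?_
    rw [sum_apply, inner_sum]
    refine Finset.sum_congr rfl fun j _ => ?_
    rw [smul_apply, inner_smul_right, ← ContinuousLinearMap.adjoint_inner_right]
    rfl
  simp only [h3]
  exact tendsto_finsetSum _ fun i _ => tendsto_finsetSum _ fun j _ =>
    (tendsto_inner_of_directedOn hD dD hs _ _).const_mul _

end IsImplementedBy

end Correspondence

/-! ### Non-degenerate and complete transfer operators. -/

section NonDegenerate

variable {H : Type*} [NormedAddCommGroup H] [InnerProductSpace ℂ H] [CompleteSpace H]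

namespace IsImplementedBy

variable {n : ℕ∞} {α : (H →L[ℂ] H) →⋆ₙₐ[ℂ] (H →L[ℂ] H)} {U : IndexSet n → (H →L[ℂ] H)}
  (hα : IsImplementedBy α U)
include hα

theorem star_mul_map_mul (a : H →L[ℂ] H) (i : IndexSet n) : star (U i) * α a * U i = a := by
  rw [hα.star_mul_map, mul_assoc, hα.star_mul_self, mul_one]

theorem map_injective (i : IndexSet n) : Function.Injective α := fun a b hab => by
  rw [← hα.star_mul_map_mul a i, hab, hα.star_mul_map_mul]

theorem norm_star_mul_mul_le (a : H →L[ℂ] H) (i : IndexSet n) :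
    ‖star (U i) * a * U i‖ ≤ ‖a‖ := by
  have h1 : ‖U i‖ ≤ 1 := ContinuousLinearMap.opNorm_le_bound _ zero_le_one fun x => by
    rw [hα.family.norm_apply, one_mul]
  calc ‖star (U i) * a * U i‖ ≤ ‖star (U i)‖ * ‖a‖ * ‖U i‖ :=
        (norm_mul_le _ _).trans (mul_le_mul_of_nonneg_right (norm_mul_le _ _) (norm_nonneg _))
    _ ≤ 1 * ‖a‖ * 1 := by
        rw [norm_star]
        gcongr
    _ = ‖a‖ := by ring

/-- The map `a ↦ (U i)* a U i` is a non-degenerate transfer operator. -/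
theorem isNonDegenerate_sandwich (i : IndexSet n) :
    IsNonDegenerateTransferOperator α (sandwich (star (U i)) (U i)) := by
  have happ : ∀ a, sandwich (star (U i)) (U i) a = star (U i) * a * U i := fun a => rfl
  have hpos : IsPositiveMap (sandwich (star (U i)) (U i)) := isPositiveMap_sandwich_adjoint (U i)
  have hpos' : ∀ a, 0 ≤ a → 0 ≤ α a := fun a ha => by
    simpa using OrderHomClass.mono α ha
  refine ⟨⟨hpos, fun a b => ?_⟩, ?_⟩
  · rw [happ, happ, ← mul_assoc, hα.star_mul_map, mul_assoc, mul_assoc, mul_assoc]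
  · refine ⟨fun a => ⟨_, rfl⟩, ?_, fun a ha => hpos' _ (hpos a ha), fun a => ?_, ?_, ?_⟩
    · rintro _ ⟨a, rfl⟩
      change α (star (U i) * α a * U i) = α a
      rw [hα.star_mul_map_mul]
    · exact (NonUnitalStarAlgHom.norm_apply_le α _).trans (hα.norm_star_mul_mul_le a i)
    · rintro _ ⟨b, rfl⟩ a
      change α (star (U i) * (α b * a) * U i) = α b * α (star (U i) * a * U i)
      rw [← map_mul, ← mul_assoc, hα.star_mul_map, mul_assoc, mul_assoc, mul_assoc]
    · rintro _ ⟨b, rfl⟩ a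
      change α (star (U i) * (a * α b) * U i) = α (star (U i) * a * U i) * α b
      rw [← map_mul, mul_assoc, mul_assoc, hα.map_mul_isometry, mul_assoc, mul_assoc]

theorem eq_one_of_existsUnique [Nontrivial H] (i₀ : IndexSet n)
    (h : ∃! L : (H →L[ℂ] H) →L[ℂ] (H →L[ℂ] H), IsNonDegenerateTransferOperator α L) :
    n = 1 := by
  have hpos : (0 : ℕ∞) < n := zero_le.trans_lt i₀.2
  have hsub : ∀ i j : IndexSet n, i = j := by
    intro i j
    by_contra hij
    have h1 := h.unique (hα.isNonDegenerate_sandwich i) (hα.isNonDegenerate_sandwich j)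
    -- The projection U_i U_i* separates the two operators: they send it to 1 and to 0.
    have h2 : star (U i) * (U i * star (U i)) * U i = star (U j) * (U i * star (U i)) * U j :=
      DFunLike.congr_fun h1 (U i * star (U i))
    rw [← mul_assoc (star (U j)), hα.star_mul_of_ne (Ne.symm hij), zero_mul, zero_mul,
      ← mul_assoc, hα.star_mul_self, one_mul, hα.star_mul_self] at h2
    exact one_ne_zero h2
  by_contra hne
  have h1 : (1 : ℕ∞) < n := lt_of_le_of_ne (Order.one_le_iff_pos.mpr hpos) (Ne.symm hne)
  have h2 := hsub ⟨0, by simpa using hpos⟩ ⟨1, by simpa using h1⟩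
  simp at h2

theorem map_eq_of_eq_one (hn : n = 1) (i₀ : IndexSet n) (a : H →L[ℂ] H) :
    α a = U i₀ * a * star (U i₀) := by
  subst hn
  ext y
  refine (hα.hasSum_apply a y).unique ?_
  refine hasSum_single (f := fun i => U i (a ((U i).adjoint y))) i₀ fun i hi => ?_
  refine absurd (Subtype.ext ?_) hi
  have h1 : i.1 < 1 := by exact_mod_cast i.2
  have h2 : i₀.1 < 1 := by exact_mod_cast i₀.2
  omega

theorem eq_sandwich_of_eq_one (hn : n = 1) (i₀ : IndexSet n)
    {L : (H →L[ℂ] H) →L[ℂ] (H →L[ℂ] H)} (hL : IsNonDegenerateTransferOperator α L) :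
    L = sandwich (star (U i₀)) (U i₀) := by
  have h1 : L 1 = 1 := by
    refine hα.map_injective i₀ ?_
    have h2 : α (L (α 1)) = α 1 := hL.nonDegenerate.apply_of_mem (α 1) ⟨1, rfl⟩
    have h3 := hL.isTransferOperator.map_one_mul 1
    rw [mul_one] at h3
    rwa [h3] at h2
  ext1 x
  -- For n = 1 the compression of x by α(1) lies in the range of α, where the transfer identity and
  -- L(1) = 1 determine L.
  have h2 : α 1 * x * α 1 = α (star (U i₀) * x * U i₀) * 1 := by
    rw [hα.map_eq_of_eq_one hn i₀ 1, hα.map_eq_of_eq_one hn i₀ (_ * _)]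
    noncomm_ring
  rw [← hL.isTransferOperator.map_one_mul, ← hL.isTransferOperator.mul_map_one, h2,
    hL.isTransferOperator.transfer, h1, mul_one]
  rfl

omit hα in
theorem _root_.ContinuousLinearMap.apply_eq_zero_of_inner_eq_zero {b : H →L[ℂ] H} (hb : 0 ≤ b)
    {y : H} (hy : inner ℂ y (b y) = 0) : b y = 0 := by
  obtain ⟨c, rfl⟩ := CStarAlgebra.nonneg_iff_eq_star_mul_self.mp hb
  change inner ℂ y (c.adjoint (c y)) = 0 at hy
  rw [ContinuousLinearMap.adjoint_inner_right, inner_self_eq_zero] at hy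
  change c.adjoint (c y) = 0
  rw [hy, map_zero]

theorem isComplete_sandwich_of_eq_one (hn : n = 1) (i₀ : IndexSet n) :
    IsCompleteTransferOperator α (sandwich (star (U i₀)) (U i₀)) where
  isTransferOperator := (hα.isNonDegenerate_sandwich i₀).isTransferOperator
  unitalKernel := ⟨0, map_zero α, fun a ha => by
    rw [hα.map_injective i₀ (ha.trans (map_zero α).symm), zero_mul, and_self]⟩
  hereditaryRange := by
    rintro b _ hb hbc ⟨a, rfl⟩
    refine ⟨star (U i₀) * b * U i₀, ?_⟩
    have h1 : b * α 1 = b := by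
      rw [← sub_eq_zero, ← neg_sub, neg_eq_zero]
      ext z
      -- α(a) vanishes at v = z − α(1)z, so 0 ≤ ⟨v, bv⟩ ≤ ⟨v, α(a)v⟩ = 0.
      have h2 : b (z - α 1 z) = 0 := by
        refine ContinuousLinearMap.apply_eq_zero_of_inner_eq_zero hb (le_antisymm ?_
          (nonneg_iff_inner.mp hb _))
        refine ((isPositiveMap_vectorFunctional (z - α 1 z)).monotone hbc).trans_eq ?_
        have h3 : α a (α 1 z) = α a z := by
          rw [← mul_apply_eq_comp, ← map_mul, mul_one]
        rw [vectorFunctional_apply, map_sub, h3, sub_self, inner_zero_right]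
      rwa [map_sub] at h2
    have h2 : α 1 * b = b := by
      have h3 := congrArg star h1
      rwa [star_mul, ← map_star, star_one, (IsSelfAdjoint.of_nonneg hb).star_eq] at h3
    conv_rhs => rw [← h1, ← h2]
    rw [hα.map_eq_of_eq_one hn i₀ 1, hα.map_eq_of_eq_one hn i₀ (_ * _)]
    noncomm_ring
  mem_annihilator a k hk := by
    rw [hα.map_injective i₀ (hk.trans (map_zero α).symm), mul_zero]
  map_eq a := by
    change α (star (U i₀) * a * U i₀) = _
    rw [hα.map_eq_of_eq_one hn i₀ 1, hα.map_eq_of_eq_one hn i₀ (_ * _)]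
    noncomm_ring

end IsImplementedBy

end NonDegenerate

/-! ### Uncountably many almost disjoint subsets of ℕ. -/

section AlmostDisjoint

/-- The code of the restriction of `t` to `{0, …, k - 1}`. -/
def prefixCode (t : ℕ → Bool) (k : ℕ) : ℕ :=
  Nat.pair k (Encodable.encode ((List.range k).map t))

/-- If t and s differ at m, a common code has length at most m, so the two sets of codes have finite
intersection. -/
theorem eq_and_agree_of_prefixCode_eq {t s : ℕ → Bool} {k l : ℕ}
    (h : prefixCode t k = prefixCode s l) : k = l ∧ ∀ i < k, t i = s i := by
  obtain ⟨rfl, h2⟩ := Nat.pair_eq_pair.mp h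
  refine ⟨rfl, fun i hi => ?_⟩
  exact List.map_inj_left.mp (Encodable.encode_injective h2) i (List.mem_range.mpr hi)

theorem prefixCode_injective (t : ℕ → Bool) : Function.Injective (prefixCode t) := fun _ _ h =>
  (eq_and_agree_of_prefixCode_eq h).1

theorem not_countable_nat_bool : ¬ Countable (ℕ → Bool) := by
  classical
  intro h
  obtain ⟨f, hf⟩ := exists_injective_nat (ℕ → Bool)
  refine Function.cantor_injective (fun s : Set ℕ => f fun k => decide (k ∈ s)) fun s t hst => ?_
  ext k
  have := congrFun (hf hst) k
  simpa using this

end AlmostDisjoint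

/-! ### Separability and the existence of implementing isometries. -/

section Separable

set_option linter.unusedSectionVars false

universe u

variable {H : Type*} [NormedAddCommGroup H] [InnerProductSpace ℂ H]

/-- Orthonormal vectors lie at distance √2, so the balls of radius 1/2 about them are disjoint. -/
theorem Orthonormal.countable_of_separableSpace [TopologicalSpace.SeparableSpace H] {ι : Type*}
    {v : ι → H} (hv : Orthonormal ℂ v) : Countable ι := by
  refine Pairwise.countable_of_isOpen_disjoint (s := fun i => Metric.ball (v i) (1 / 2)) ?_
    (fun _ => Metric.isOpen_ball) fun i => ⟨v i, Metric.mem_ball_self (by norm_num)⟩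
  intro i j hij
  refine Metric.ball_disjoint_ball ?_
  have h : ‖v i - v j‖ ^ 2 = 2 := by
    rw [@norm_sub_sq ℂ, hv.1 i, hv.1 j, hv.2 hij]
    norm_num
  rw [dist_eq_norm]
  nlinarith [norm_nonneg (v i - v j)]

variable [CompleteSpace H]

theorem Orthonormal.exists_linearIsometry {ι : Type*} (g : HilbertBasis ι ℂ H) {v : ι → H}
    (hv : Orthonormal ℂ v) : ∃ V : H →ₗᵢ[ℂ] H, ∀ i, V (g i) = v i := by
  classical
  refine ⟨hv.orthogonalFamily.linearIsometry.comp g.repr.toLinearIsometry, fun i => ?_⟩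
  change hv.orthogonalFamily.linearIsometry (g.repr (g i)) = v i
  rw [g.repr_self, OrthogonalFamily.linearIsometry_apply_single]
  simp

theorem HilbertBasis.eq_sum_rankOne {ι : Type*} (g : HilbertBasis ι ℂ H) {T : H →L[ℂ] H}
    (F : Finset ι) (hT : ∀ l ∉ F, T (g l) = 0) :
    T = ∑ l ∈ F, InnerProductSpace.rankOne ℂ (T (g l)) (g l) := by
  classical
  refine ContinuousLinearMap.ext_on
    (Submodule.dense_iff_topologicalClosure_eq_top.mpr g.dense_span) ?_
  rintro _ ⟨k, rfl⟩
  rw [sum_apply]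
  by_cases hk : k ∈ F
  · rw [Finset.sum_eq_single k]
    · rw [InnerProductSpace.rankOne_apply, inner_self_eq_norm_sq_to_K, g.orthonormal.1 k]
      simp
    · intro l _ hl
      rw [InnerProductSpace.rankOne_apply, g.orthonormal.2 hl, zero_smul]
    · exact fun h => absurd hk h
  · rw [hT k hk, Finset.sum_eq_zero]
    intro l hl
    rw [InnerProductSpace.rankOne_apply, g.orthonormal.2 (by rintro rfl; exact hk hl), zero_smul]

theorem HilbertBasis.eq_zero_of_inner_eq_zero {ι : Type*} (g : HilbertBasis ι ℂ H) {x : H}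
    (hx : ∀ i, inner ℂ (g i) x = 0) : x = 0 := by
  have h := g.hasSum_repr x
  simp only [g.repr_apply_apply, hx, zero_smul] at h
  exact h.unique hasSum_zero

/-- A representation of `B(H)` on a separable Hilbert space has no singular part: if a vector is
annihilated by the images of all rank-one operators, it is annihilated by the image of `1`. -/
theorem map_one_apply_eq_zero_of_rankOne [TopologicalSpace.SeparableSpace H]
    (α : (H →L[ℂ] H) →⋆ₙₐ[ℂ] (H →L[ℂ] H)) {z : H}
    (hz : ∀ x y, α (InnerProductSpace.rankOne ℂ x y) z = 0) : α 1 z = 0 := by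
  obtain ⟨w, g, -⟩ := exists_hilbertBasis ℂ H
  have hkill : ∀ (T : H →L[ℂ] H) (F : Finset w), (∀ l ∉ F, T (g l) = 0) → α T z = 0 := by
    intro T F hT
    rw [g.eq_sum_rankOne F hT, map_sum, sum_apply]
    exact Finset.sum_eq_zero fun l _ => hz _ _
  cases finite_or_infinite w with
  | inl hfin =>
    have := Fintype.ofFinite w
    exact hkill 1 Finset.univ fun l hl => absurd (Finset.mem_univ l) hl
  | inr hinf =>
    by_contra hne
    have : Countable w := g.orthonormal.countable_of_separableSpace
    obtain ⟨E⟩ := nonempty_equiv_of_countable (α := w) (β := ℕ)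
    have hφ : ∀ t, Function.Injective fun k : w => E.symm (prefixCode t (E k)) := fun t =>
      E.symm.injective.comp ((prefixCode_injective t).comp E.injective)
    -- V_t maps the basis into the part of it labelled by the codes of t. For t ≠ s, V_t* V_s has
    -- finite rank, so the vectors α(V_t)z are mutually orthogonal, all of norm ‖α(1)z‖.
    choose V hV using fun t =>
      (g.orthonormal.comp (fun k : w => E.symm (prefixCode t (E k))) (hφ t)).exists_linearIsometry g
    let W : (ℕ → Bool) → (H →L[ℂ] H) := fun t => (V t).toContinuousLinearMap
    have hself : ∀ t, star (W t) * W t = 1 := fun t => by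
      ext x
      refine ext_inner_left ℂ fun y => ?_
      change inner ℂ y ((W t).adjoint (W t x)) = inner ℂ y x
      rw [ContinuousLinearMap.adjoint_inner_right]
      exact (V t).inner_map_map y x
    have hcross : ∀ t s, t ≠ s → α (star (W t) * W s) z = 0 := by
      intro t s hts
      obtain ⟨m, hm⟩ := Function.ne_iff.mp hts
      -- A common code has length at most m, so only the basis vectors numbered 0, …, m can survive.
      refine hkill _ ((Finset.range (m + 1)).map E.symm.toEmbedding) fun l hl => ?_
      refine g.eq_zero_of_inner_eq_zero fun k => ?_
      change inner ℂ (g k) ((W t).adjoint (W s (g l))) = 0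
      rw [ContinuousLinearMap.adjoint_inner_right]
      change inner ℂ (V t (g k)) (V s (g l)) = 0
      rw [hV, hV]
      refine g.orthonormal.2 fun heq => hl ?_
      obtain ⟨h1, h2⟩ := eq_and_agree_of_prefixCode_eq (E.symm.injective heq)
      have h3 : E k ≤ m := by
        by_contra hlt
        exact hm (h2 m (not_le.mp hlt))
      refine Finset.mem_map.mpr ⟨E l, Finset.mem_range.mpr (by omega), ?_⟩
      exact E.symm_apply_apply l
    have hinner : ∀ t s, inner ℂ (α (W t) z) (α (W s) z) = inner ℂ z (α (star (W t) * W s) z) := by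
      intro t s
      rw [map_mul, map_star, mul_apply_eq_comp, ContinuousLinearMap.star_eq_adjoint,
        ContinuousLinearMap.adjoint_inner_right]
    have hnorm : ∀ t, ‖α (W t) z‖ = ‖α 1 z‖ := by
      intro t
      rw [@norm_eq_sqrt_re_inner ℂ, @norm_eq_sqrt_re_inner ℂ _ _ _ _ (α 1 z), hinner, hself]
      have h1 : inner ℂ (α 1 z) (α 1 z) = inner ℂ z (α 1 z) := by
        rw [← ContinuousLinearMap.adjoint_inner_right (α 1), ← ContinuousLinearMap.star_eq_adjoint,
          ← map_star, star_one, ← mul_apply_eq_comp, ← map_mul, one_mul]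
      rw [h1]
    have horth : Orthonormal ℂ fun t => ((‖α 1 z‖⁻¹ : ℝ) : ℂ) • α (W t) z := by
      refine ⟨fun t => ?_, fun t s hts => ?_⟩
      · rw [norm_smul, hnorm, Complex.norm_real, norm_inv, norm_norm,
          inv_mul_cancel₀ (norm_ne_zero_iff.mpr hne)]
      · simp only [inner_smul_left, inner_smul_right, hinner, hcross t s hts, inner_zero_right,
          mul_zero]
    exact not_countable_nat_bool horth.countable_of_separableSpace

theorem exists_indexSet_equiv (ι : Type*) [Countable ι] : ∃ n : ℕ∞, Nonempty (IndexSet n ≃ ι) := by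
  cases finite_or_infinite ι with
  | inl hfin =>
    refine ⟨(Nat.card ι : ℕ), ⟨Equiv.trans ?_ (Finite.equivFin ι).symm⟩⟩
    exact
      { toFun := fun i => ⟨i.1, Nat.cast_lt.mp i.2⟩
        invFun := fun i => ⟨i.1, Nat.cast_lt.mpr i.2⟩
        left_inv := fun _ => rfl
        right_inv := fun _ => rfl }
  | inr hinf =>
    obtain ⟨E⟩ := nonempty_equiv_of_countable (α := ℕ) (β := ι)
    exact ⟨⊤, ⟨(Equiv.subtypeUnivEquiv fun i => ENat.natCast_lt_top i).trans E⟩⟩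

theorem exists_orthonormal_fixed_points {H : Type u} [NormedAddCommGroup H]
    [InnerProductSpace ℂ H] [CompleteSpace H] (p : H →L[ℂ] H) :
    ∃ (w : Type u) (f : w → H), Orthonormal ℂ f ∧ (∀ i, p (f i) = f i) ∧
      ∀ v, p v = v → (∀ i, inner ℂ (f i) v = 0) → v = 0 := by
  set M : Submodule ℂ H := LinearMap.ker ((p - 1 : H →L[ℂ] H) : H →ₗ[ℂ] H) with hM
  have hmem : ∀ v, v ∈ M ↔ p v = v := fun v => by
    rw [hM, LinearMap.mem_ker]
    exact sub_eq_zero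
  have hcl : IsClosed (M : Set H) := ContinuousLinearMap.isClosed_ker (p - 1)
  have : CompleteSpace M := hcl.completeSpace_coe
  obtain ⟨w, b, -⟩ := exists_hilbertBasis ℂ M
  refine ⟨w, fun i => b i, b.orthonormal.comp_linearIsometry M.subtypeₗᵢ,
    fun i => (hmem _).mp (b i).2, fun v hv h => ?_⟩
  have h1 : (⟨v, (hmem v).mpr hv⟩ : M) = 0 := b.eq_zero_of_inner_eq_zero fun i => h i
  exact congrArg Subtype.val h1

/-- Every endomorphism of `B(H)`, with `H` separable, is implemented by a family of isometries. -/
theorem exists_isImplementedBy [TopologicalSpace.SeparableSpace H] [Nontrivial H]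
    (α : (H →L[ℂ] H) →⋆ₙₐ[ℂ] (H →L[ℂ] H)) :
    ∃ (n : ℕ∞) (U : IndexSet n → (H →L[ℂ] H)), IsImplementedBy α U := by
  obtain ⟨ξ, hξ⟩ := exists_norm_eq H zero_le_one
  have hξξ : inner ℂ ξ ξ = (1 : ℂ) := by
    rw [inner_self_eq_norm_sq_to_K, hξ]
    simp
  have hmul : ∀ x y u v : H, InnerProductSpace.rankOne ℂ x y * InnerProductSpace.rankOne ℂ u v =
      (inner ℂ y u : ℂ) • (InnerProductSpace.rankOne ℂ x v : H →L[ℂ] H) := fun x y u v =>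
    InnerProductSpace.rankOne_comp_rankOne x y u v
  have hstar : ∀ x y : H, star (InnerProductSpace.rankOne ℂ x y : H →L[ℂ] H) =
      InnerProductSpace.rankOne ℂ y x := fun x y =>
    InnerProductSpace.adjoint_rankOne x y
  obtain ⟨w, f, hf, hfix, htotal⟩ :=
    exists_orthonormal_fixed_points (α (InnerProductSpace.rankOne ℂ ξ ξ))
  have : Countable w := hf.countable_of_separableSpace
  obtain ⟨n, ⟨E⟩⟩ := exists_indexSet_equiv w
  have hadj : ∀ (a : H →L[ℂ] H) x y, inner ℂ (α a x) y = inner ℂ x (α (star a) y) := by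
    intro a x y
    rw [map_star, ContinuousLinearMap.star_eq_adjoint, ContinuousLinearMap.adjoint_inner_right]
  have hinner : ∀ (i j : w) (x y : H), inner ℂ (α (InnerProductSpace.rankOne ℂ x ξ) (f i))
      (α (InnerProductSpace.rankOne ℂ y ξ) (f j)) = inner ℂ x y * inner ℂ (f i) (f j) := by
    intro i j x y
    rw [hadj, hstar, ← mul_apply_eq_comp, ← map_mul, hmul, map_smul, smul_apply, hfix,
      inner_smul_right]
  -- A unit vector f_i fixed by α(|ξ⟩⟨ξ|) gives the isometry x ↦ α(|x⟩⟨ξ|) f_i, which intertwines a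
  -- and α(a).
  let V : w → (H →ₗᵢ[ℂ] H) := fun i => LinearMap.isometryOfInner
    { toFun := fun x => α (InnerProductSpace.rankOne ℂ x ξ) (f i)
      map_add' := fun x y => by simp
      map_smul' := fun c x => by simp }
    fun x y => (hinner i i x y).trans (by
      rw [inner_self_eq_norm_sq_to_K, hf.1 i]
      simp)
  let U : IndexSet n → (H →L[ℂ] H) := fun i => (V (E i)).toContinuousLinearMap
  have hUapp : ∀ i x, U i x = α (InnerProductSpace.rankOne ℂ x ξ) (f (E i)) := fun _ _ => rfl
  have hU : IsOrthogonalIsometryFamily U := ⟨fun i => (V (E i)).isometry, fun i j hij x y => by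
    rw [hUapp, hUapp, hinner, hf.2 (E.injective.ne hij), mul_zero]⟩
  have hαU : ∀ (a : H →L[ℂ] H) i x, α a (U i x) = U i (a x) := by
    intro a i x
    rw [hUapp, hUapp, ← mul_apply_eq_comp, ← map_mul]
    exact congrArg (fun T => α T (f (E i))) (InnerProductSpace.comp_rankOne x ξ a)
  -- For z orthogonal to all the ranges, α(|ξ⟩⟨x|)z is fixed by α(|ξ⟩⟨ξ|) and orthogonal to every
  -- f_i, hence zero. Then all rank-one operators kill z, and separability gives α(1)z = 0.
  have hzero : ∀ z, (∀ i, (U i).adjoint z = 0) → ∀ a, α a z = 0 := by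
    intro z hz a
    have h1 : ∀ x, α (InnerProductSpace.rankOne ℂ ξ x) z = 0 := by
      intro x
      refine htotal _ ?_ fun i => ?_
      · rw [← mul_apply_eq_comp, ← map_mul, hmul, hξξ, one_smul]
      · rw [← hstar, ← hadj]
        have h2 := ContinuousLinearMap.adjoint_inner_right (U (E.symm i)) x z
        rwa [hz, inner_zero_right, hUapp, E.apply_symm_apply, eq_comm] at h2
    have h2 : ∀ x y, α (InnerProductSpace.rankOne ℂ x y) z = 0 := by
      intro x y
      have h3 := hmul x ξ ξ y
      rw [hξξ, one_smul] at h3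
      rw [← h3, map_mul, mul_apply_eq_comp, h1, map_zero]
    rw [← mul_one a, map_mul, mul_apply_eq_comp, map_one_apply_eq_zero_of_rankOne α h2, map_zero]
  refine ⟨n, U, hU.isometry, hU.orthogonal, fun a x y => ?_⟩
  -- R = ∑ U_i U_i* is the projection onto the span of the ranges; α(a) vanishes on y − R y.
  obtain ⟨R, hR⟩ := hU.exists_ampliation 1
  have h1 : α a (y - R y) = 0 := hzero _ (fun i => by
    rw [map_sub, hU.adjoint_apply_of_hasSum (hR y) i]
    exact sub_self _) a
  rw [map_sub, sub_eq_zero] at h1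
  rw [h1]
  have h2 := (innerSL ℂ x).hasSum ((α a).hasSum (hR y))
  simp only [hαU] at h2
  exact h2

end Separable

theorem IsImplementedBy.one_le {H : Type*} [NormedAddCommGroup H] [InnerProductSpace ℂ H]
    [CompleteSpace H] {n : ℕ∞} {α : (H →L[ℂ] H) →⋆ₙₐ[ℂ] (H →L[ℂ] H)}
    {U : IndexSet n → (H →L[ℂ] H)} (hα : IsImplementedBy α U) (h0 : α ≠ 0) : 1 ≤ n := by
  rw [Order.one_le_iff_pos, pos_iff_ne_zero]
  rintro rfl
  refine h0 ?_
  ext a y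
  refine (hα.hasSum_apply a y).unique ?_
  have : IsEmpty (IndexSet 0) := ⟨fun i => not_lt_zero i.2⟩
  exact hasSum_empty

theorem mainTheorem7 {H : Type*} [NormedAddCommGroup H] [InnerProductSpace ℂ H] [CompleteSpace H]
    [TopologicalSpace.SeparableSpace H]
    {K : Type*} [NormedAddCommGroup K] [InnerProductSpace ℂ K] [CompleteSpace K]
    (α : (H →L[ℂ] H) →⋆ₙₐ[ℂ] (H →L[ℂ] H)) (hα : α ≠ 0) :
    -- existence of an index and of implementing isometries
    (∃ n : ℕ∞, 1 ≤ n ∧ ∃ U : IndexSet n → (H →L[ℂ] H), IsImplementedBy α U) ∧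
    -- for every choice of the isometries, of one of them, and of an orthonormal basis of `K`
    ∀ (n : ℕ∞) (U : IndexSet n → (H →L[ℂ] H)), IsImplementedBy α U →
      ∀ (i₀ : IndexSet n) (e : HilbertBasis (IndexSet n) ℂ K),
        -- the series defining `a ⊗ b` is weakly convergent
        (∀ a ∈ cornerAlgebra (U i₀), ∀ b : K →L[ℂ] K,
          IsElementaryTensor U i₀ e a b (elementaryTensor U i₀ e a b)) ∧
        -- the form of transfer operators
        (∀ L : (H →L[ℂ] H) →L[ℂ] (H →L[ℂ] H), IsTransferOperator α L →
          ∃ ω : (K →L[ℂ] K) →L[ℂ] ℂ, IsPositiveMap ω ∧ IsTensorRelated U i₀ e L ω) ∧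
        -- (i) isometric isomorphism of cones
        (∃ Φ : normalTransferCone α ≃ₗ[{c : ℝ // 0 ≤ c}] normalFunctionalCone (K →L[ℂ] K),
          (∀ (L : normalTransferCone α) (ω : normalFunctionalCone (K →L[ℂ] K)),
            IsTensorRelated U i₀ e L.1 ω.1 ↔ Φ L = ω) ∧
          (∀ L : normalTransferCone α, ‖(Φ L).1‖ = ‖L.1‖) ∧ Isometry Φ) ∧
        -- (ii) singularity, and normality for finite index
        (∀ (L : (H →L[ℂ] H) →L[ℂ] (H →L[ℂ] H)) (ω : (K →L[ℂ] K) →L[ℂ] ℂ),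
          IsTransferOperator α L → IsPositiveMap ω → IsTensorRelated U i₀ e L ω →
            (IsSingularMap L ↔ IsSingularMap ω)) ∧
        (n ≠ ⊤ → ∀ L : (H →L[ℂ] H) →L[ℂ] (H →L[ℂ] H), IsTransferOperator α L → IsNormalMap L) ∧
        -- (iii) uniqueness of non-degenerate transfer operators
        ((∃! L : (H →L[ℂ] H) →L[ℂ] (H →L[ℂ] H), IsNonDegenerateTransferOperator α L) ↔ n = 1) ∧
        (n = 1 →
          (∀ a : H →L[ℂ] H, α a = U i₀ * a * star (U i₀)) ∧
          ∃ L : (H →L[ℂ] H) →L[ℂ] (H →L[ℂ] H), IsNonDegenerateTransferOperator α L ∧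
            IsCompleteTransferOperator α L ∧
            ∀ a : H →L[ℂ] H, L a = star (U i₀) * a * U i₀) := by
  have hH : Nontrivial H := by
    by_contra h
    rw [not_nontrivial_iff_subsingleton] at h
    exact hα (by ext a x; exact Subsingleton.elim _ _)
  refine ⟨?_, fun n U hU i₀ e => ⟨fun a _ b => ?_, fun L hL => ?_, hU.exists_coneEquiv e i₀,
    fun L ω hL _ h => hU.isSingularMap_iff e hL h, fun hn L hL => ?_,
    ⟨hU.eq_one_of_existsUnique i₀, fun hn => ?_⟩, fun hn => ⟨hU.map_eq_of_eq_one hn i₀, ?_⟩⟩⟩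
  · obtain ⟨n, U, hU⟩ := exists_isImplementedBy α
    exact ⟨n, hU.one_le hα, U, hU⟩
  · rw [hU.elementaryTensor_eq]
    exact hU.isElementaryTensor e i₀ a b
  · obtain ⟨ξ, hξ⟩ := exists_norm_eq H zero_le_one
    exact ⟨_, hU.isPositiveMap_functional e ξ hL.positive, hU.isTensorRelated_functional e i₀ hξ hL⟩
  · obtain ⟨ξ, hξ⟩ := exists_norm_eq H zero_le_one
    exact hU.isNormalMap_of_ne_top e hn hL (hU.isTensorRelated_functional e i₀ hξ hL)
  · exact ⟨_, hU.isNonDegenerate_sandwich i₀, fun L hL => hU.eq_sandwich_of_eq_one hn i₀ hL⟩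
  · exact ⟨_, hU.isNonDegenerate_sandwich i₀, hU.isComplete_sandwich_of_eq_one hn i₀,
      fun a => rfl⟩
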